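/- For a partition $\rho$ (identified with its Young diagram), let $\rho'$ be the transposed partition and let $C(\rho)$ be the number of corners of $\rho$, i.e. the number of boxes of the Young diagram of $\rho$ whose removal leaves a Young diagram. For partitions $\mu,\nu,\lambda\vdash n$ let $$g_{\mu\nu\lambda}=\frac1{n!}\sum_{\sigma\in S_n}\chi_\mu(\sigma)\chi_\nu(\sigma)\chi_\lambda(\sigma)$$ be the Kronecker coefficient, where $\chi_\mu$ is the irreducible character of the symmetric group $S_n$ labelled by $\mu$ (the character of the Specht module $S^\mu$). Let $n\ge 2$. Then: 1. $g_{(2,1^{n-2})\,\nu'\lambda}\in\{0,1\}$ for all $\nu,\lambda\vdash n$ with $\nu\ne\lambda$; 2. $g_{(2,1^{n-2})\,\nu'\nu}=C(\nu)-1$ for all $\nu\vdash n$; 3. $$\sum_{\nu,\lambda\vdash n} g_{(2,1^{n-2})\,\nu'\lambda}^2=\sum_{\rho\vdash n-1}C(\rho)\,(C(\rho)+1)+\sum_{\rho\vdash n}(C(\rho)-1)^2 .$$ -/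

import Mathlib

namespace SymKron

/-! ### Partitions of `n`, as Young diagrams with `n` boxes -/

/-- Partitions of `n`, viewed as Young diagrams with `n` boxes. -/
abbrev Par (n : ℕ) : Type := {μ : YoungDiagram // μ.card = n}

theorem cells_subset_of_card {n : ℕ} (μ : Par n) :
    μ.1.cells ⊆ Finset.range n ×ˢ Finset.range n := by
  rintro ⟨i, j⟩ h
  have hc : μ.1.cells.card = n := μ.2
  have hi : (Finset.range (i + 1)).card ≤ μ.1.cells.card := by
    refine Finset.card_le_card_of_injOn (fun k => (k, j)) ?_ ?_
    · intro k hk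
      have hk' : k < i + 1 := Finset.mem_range.mp hk
      exact μ.1.up_left_mem (Nat.lt_succ_iff.mp hk') le_rfl h
    · intro a _ b _ hab
      exact congrArg Prod.fst hab
  have hj : (Finset.range (j + 1)).card ≤ μ.1.cells.card := by
    refine Finset.card_le_card_of_injOn (fun k => (i, k)) ?_ ?_
    · intro k hk
      have hk' : k < j + 1 := Finset.mem_range.mp hk
      exact μ.1.up_left_mem le_rfl (Nat.lt_succ_iff.mp hk') h
    · intro a _ b _ hab
      exact congrArg Prod.snd hab
  rw [Finset.card_range, hc] at hi hj
  simp only [Finset.mem_product, Finset.mem_range]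
  omega

instance finite_par (n : ℕ) : Finite (Par n) := by
  refine Finite.of_injective
    (fun μ : Par n =>
      (⟨μ.1.cells, Finset.mem_powerset.mpr (cells_subset_of_card μ)⟩ :
        (Finset.range n ×ˢ Finset.range n).powerset)) ?_
  intro μ ν h
  exact Subtype.ext (YoungDiagram.ext (congrArg Subtype.val h))

noncomputable instance fintypePar (n : ℕ) : Fintype (Par n) := Fintype.ofFinite _

/-- The transposed (conjugate) partition `μ'`. -/
def Par.transpose {n : ℕ} (μ : Par n) : Par n :=
  ⟨μ.1.transpose, by
    have h := μ.2
    simpa [YoungDiagram.transpose, YoungDiagram.card] using h⟩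

theorem card_cellsOfRowLens (w : List ℕ) :
    (YoungDiagram.cellsOfRowLens w).card = w.sum := by
  induction w with
  | nil => simp [YoungDiagram.cellsOfRowLens]
  | cons a w ih =>
    rw [YoungDiagram.cellsOfRowLens, Finset.card_union_of_disjoint]
    · simp [ih]
    · rw [Finset.disjoint_left]
      rintro ⟨i, j⟩ h1 h2
      simp at h1 h2
      omega

/-- The hook partition `(2, 1, …, 1)` of `n`, with `n - 2` parts equal to `1`, for `n ≥ 2`. -/
def hookTwo (n : ℕ) (hn : 2 ≤ n) : Par n :=
  ⟨YoungDiagram.ofRowLens (2 :: List.replicate (n - 2) 1) (by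
      rw [List.sortedGE_iff_pairwise, List.pairwise_cons]
      refine ⟨fun b hb => ?_, List.pairwise_replicate.mpr (Or.inr le_rfl)⟩
      rw [List.eq_of_mem_replicate hb]
      omega), by
    have h := card_cellsOfRowLens (2 :: List.replicate (n - 2) 1)
    simp only [List.sum_cons, List.sum_replicate, smul_eq_mul, mul_one] at h
    change (YoungDiagram.cellsOfRowLens (2 :: List.replicate (n - 2) 1)).card = n
    omega⟩

/-- The corners of a Young diagram: the boxes whose removal leaves a Young diagram. -/
def corners (μ : YoungDiagram) : Set (ℕ × ℕ) :=
  {c | c ∈ μ.cells ∧ IsLowerSet ((μ.cells.erase c : Finset (ℕ × ℕ)) : Set (ℕ × ℕ))}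

/-- `C(μ)`, the number of corners of the Young diagram `μ`. -/
noncomputable def numCorners (μ : YoungDiagram) : ℕ := (corners μ).ncard

/-! ### Specht modules

`α` is a finite set of labels; the symmetric group on `n` letters is `Equiv.Perm (Fin n)`. -/

/-- A row assignment `f : α → ℕ` places the label `x` in row `f x`.  The row assignments for which
row `i` receives exactly `μ_i` labels are the tabloids of shape `μ`.  This is the permutation
representation of `Perm α` on the complex vector space with basis all row assignments, where
`σ` sends `f` to `f ∘ σ⁻¹`; it contains the permutation module on the tabloids of every shape. -/
noncomputable def tabloidRep (α : Type*) :
    Representation ℂ (Equiv.Perm α) ((α → ℕ) →₀ ℂ) where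
  toFun σ := Finsupp.lmapDomain ℂ ℂ (fun f : α → ℕ => f ∘ ⇑σ⁻¹)
  map_one' := by
    ext f
    simp
  map_mul' σ τ := by
    ext f
    simp [Function.comp_assoc]

/-- A Young tableau of shape `μ`: a bijective filling of the boxes of `μ` with the labels `α`. -/
abbrev Tableau (α : Type*) (μ : YoungDiagram) : Type _ := {c : ℕ × ℕ // c ∈ μ.cells} ≃ α

section
variable {α : Type*} {μ : YoungDiagram}

/-- The row of the label `x` in the tableau `T`; as a function of `x`, the tabloid of `T`. -/
def Tableau.row (T : Tableau α μ) (x : α) : ℕ := (T.symm x).1.1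

/-- The column of the label `x` in the tableau `T`. -/
def Tableau.col (T : Tableau α μ) (x : α) : ℕ := (T.symm x).1.2

/-- Relabelling a tableau by a permutation of the labels. -/
def Tableau.act (σ : Equiv.Perm α) (T : Tableau α μ) : Tableau α μ := T.trans σ

variable [Fintype α] [DecidableEq α]

/-- The polytabloid `e_T`: the sum of `sign σ • {σ T}` over the permutations `σ` that preserve
every column of `T`. -/
noncomputable def polytabloid (T : Tableau α μ) : (α → ℕ) →₀ ℂ :=
  ∑ σ : Equiv.Perm α with ∀ x, T.col (σ x) = T.col x,
    Finsupp.single (Tableau.act σ T).row ((Equiv.Perm.sign σ : ℤ) : ℂ)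

theorem tabloidRep_polytabloid (τ : Equiv.Perm α) (T : Tableau α μ) :
    tabloidRep α τ (polytabloid T) = polytabloid (Tableau.act τ T) := by
  simp only [polytabloid, map_sum]
  refine Finset.sum_bij' (fun σ _ => τ * σ * τ⁻¹) (fun σ _ => τ⁻¹ * σ * τ) ?_ ?_ ?_ ?_ ?_
  · intro σ hσ
    simp only [Finset.mem_filter, Finset.mem_univ, true_and] at hσ ⊢
    intro x
    have := hσ (τ⁻¹ x)
    simpa [Tableau.col, Tableau.act] using this
  · intro σ hσ
    simp only [Finset.mem_filter, Finset.mem_univ, true_and] at hσ ⊢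
    intro x
    have := hσ (τ x)
    simpa [Tableau.col, Tableau.act] using this
  · intro σ _
    group
  · intro σ _
    group
  · intro σ _
    have h1 : Equiv.Perm.sign (τ * σ * τ⁻¹) = Equiv.Perm.sign σ := by
      rw [Equiv.Perm.sign_mul, Equiv.Perm.sign_mul, Equiv.Perm.sign_inv, mul_right_comm,
        Int.units_mul_self, one_mul]
    rw [h1]
    simp only [tabloidRep, MonoidHom.coe_mk, OneHom.coe_mk, Finsupp.lmapDomain_apply,
      Finsupp.mapDomain_single]
    congr 1
    funext x
    have h2 : (τ * σ * τ⁻¹).symm x = τ (σ.symm (τ.symm x)) := rfl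
    simp [Tableau.row, Tableau.act, h2]

end

/-- The Specht module `S^μ` of the symmetric group on `α`: the span of the polytabloids of all
tableaux of shape `μ`.  (It is only meaningful when `μ` has as many boxes as `α` has elements.) -/
noncomputable def specht (α : Type*) [Fintype α] [DecidableEq α] (μ : YoungDiagram) :
    Subrepresentation (tabloidRep α) where
  toSubmodule := Submodule.span ℂ (Set.range fun T : Tableau α μ => polytabloid T)
  apply_mem_toSubmodule τ v hv := by
    induction hv using Submodule.span_induction with
    | mem v hv =>
      obtain ⟨T, rfl⟩ := hv
      rw [tabloidRep_polytabloid]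
      exact Submodule.subset_span ⟨_, rfl⟩
    | zero => simp
    | add v w _ _ hv hw =>
      rw [map_add]
      exact Submodule.add_mem _ hv hw
    | smul a v _ hv =>
      rw [map_smul]
      exact Submodule.smul_mem _ a hv

/-- Specht modules are finite-dimensional, so that their characters are honest traces. -/
instance finiteDimensional_specht (α : Type*) [Fintype α] [DecidableEq α] (μ : YoungDiagram) :
    FiniteDimensional ℂ (specht α μ).toSubmodule := by
  have : Finite (Tableau α μ) := inferInstance
  exact FiniteDimensional.span_of_finite ℂ (Set.finite_range _)

/-- The irreducible character `χ_μ` of the symmetric group `S_n` labelled by the partition `μ` of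
`n`: its value at `σ` is the trace of `σ` acting on the Specht module `S^μ`. -/
noncomputable def irrChar {n : ℕ} (μ : Par n) (σ : Equiv.Perm (Fin n)) : ℂ :=
  LinearMap.trace ℂ (specht (Fin n) μ.1).toSubmodule ((specht (Fin n) μ.1).toRepresentation σ)

/-- The Kronecker coefficient
`g_{μνκ} = (1 / n!) ∑_{σ ∈ S_n} χ_μ(σ) χ_ν(σ) χ_κ(σ)`. -/
noncomputable def kronecker {n : ℕ} (μ ν κ : Par n) : ℂ :=
  (1 / (n.factorial : ℂ)) *
    ∑ σ : Equiv.Perm (Fin n), irrChar μ σ * irrChar ν σ * irrChar κ σ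

end SymKron

namespace SymKron

open Finset

/-! ### Adding and removing boxes -/

section Boxes
open Classical

/-! The character of `(2, 1^{n-2})` is `sgn * (fix - 1)`, where `fix` counts fixed points
(`irrChar_hookTwo`), and transposing a partition multiplies its character by `sgn`
(`irrChar_transpose`). The signs cancel. Since `fix` is induced from the trivial character of
`S_{n-1}`, Frobenius reciprocity gives `g = ⟨Res χ_ν, Res χ_λ⟩ - δ_{νλ}`, and by the branching rule
the pairing counts the `ρ ⊢ n-1` contained in both `ν` and `λ` (`kronecker_hookTwo`). For `ν ≠ λ`
only `ρ = ν ∩ λ` is possible; for `ν = λ` the `ρ` correspond to corners. The sum of squares then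
follows by counting triples `ρ ⊂ ν, λ` from the side of `ρ`, which has `C(ρ) + 1` addable boxes
(`card_above`).

Most of the work is the character theory. Column antisymmetrizers show that a nonzero map `S^μ →
S^ν` forces `μ` to dominate `ν` and that endomorphisms of `S^μ` are scalars, so the characters are
orthonormal (`ip_irrChar`).

The branching rule is obtained by a squeeze. Deleting a label gives a nonzero map `Res S^ν → S^ρ`
whenever `ρ ⊂ ν`, so each multiplicity is at least the one predicted. The numbers of chains in
Young's lattice have squares summing to `n!` (`sum_numChains_sq`), while Bessel's inequality bounds
the sum of squared degrees by `n!` (`sum_degree_sq_le`). By induction on `n` all inequalities are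
equalities, which yields the degrees, the completeness of the characters and the branching rule
together. -/

theorem exists_insert_cells {n : ℕ} {ρ : Par n} {ν : Par (n + 1)} (h : ρ.1 ≤ ν.1) :
    ∃ c ∉ ρ.1.cells, insert c ρ.1.cells = ν.1.cells := by
  rw [Finset.exists_eq_insert_iff]
  refine ⟨YoungDiagram.cells_subset_iff.mpr h, ?_⟩
  have h1 : ρ.1.cells.card = n := ρ.2
  have h2 : ν.1.cells.card = n + 1 := ν.2
  omega

theorem numCorners_eq_card {n : ℕ} (ν : Par (n + 1)) :
    numCorners ν.1 = #{ρ : Par n | ρ.1 ≤ ν.1} := by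
  have h2 : ν.1.cells.card = n + 1 := ν.2
  have key : (corners ν.1).ncard = {ρ : Par n | ρ.1 ≤ ν.1}.ncard := by
    refine Set.ncard_congr (fun c hc => ⟨⟨ν.1.cells.erase c, hc.2⟩, ?_⟩) ?_ ?_ ?_
    · change (ν.1.cells.erase c).card = n
      rw [Finset.card_erase_of_mem hc.1, h2]; rfl
    · intro c hc
      exact YoungDiagram.cells_subset_iff.mp (Finset.erase_subset _ _)
    · intro a b ha hb hab
      have := congrArg (fun x : Par n => x.1.cells) hab
      exact Finset.erase_injOn _ ha.1 hb.1 this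
    · intro ρ hρ
      obtain ⟨c, hc, hcc⟩ := exists_insert_cells hρ
      have he : ν.1.cells.erase c = ρ.1.cells := by rw [← hcc, Finset.erase_insert hc]
      refine ⟨c, ⟨by rw [← hcc]; exact Finset.mem_insert_self _ _, ?_⟩, ?_⟩
      · rw [he]; exact ρ.1.isLowerSet
      · exact Subtype.ext (YoungDiagram.ext he)
  rw [numCorners, key, Set.ncard_eq_toFinset_card']
  congr 1
  ext; simp

theorem mem_corners_iff {μ : YoungDiagram} {i j : ℕ} :
    (i, j) ∈ corners μ ↔ j + 1 = μ.rowLen i ∧ μ.rowLen (i + 1) < μ.rowLen i := by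
  constructor
  · rintro ⟨h1, h2⟩
    have h1' := YoungDiagram.mem_iff_lt_rowLen.mp ((YoungDiagram.mem_cells _).mp h1)
    have a1 : ¬ j + 1 < μ.rowLen i := fun h => by
      have hm : (i, j + 1) ∈ μ.cells.erase (i, j) := by
        simp [YoungDiagram.mem_iff_lt_rowLen, h]
      have := h2 (show ((i, j) : ℕ × ℕ) ≤ (i, j + 1) from ⟨le_rfl, Nat.le_succ _⟩) hm
      simp at this
    have a2 : ¬ j < μ.rowLen (i + 1) := fun h => by
      have hm : (i + 1, j) ∈ μ.cells.erase (i, j) := by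
        simp [YoungDiagram.mem_iff_lt_rowLen, h]
      have := h2 (show ((i, j) : ℕ × ℕ) ≤ (i + 1, j) from ⟨Nat.le_succ _, le_rfl⟩) hm
      simp at this
    omega
  · rintro ⟨h1, h2⟩
    refine ⟨by rw [YoungDiagram.mem_cells, YoungDiagram.mem_iff_lt_rowLen]; omega, ?_⟩
    rintro ⟨a, b⟩ ⟨c, d⟩ hle hab
    have hle' : c ≤ a ∧ d ≤ b := hle
    simp only [coe_erase, Set.mem_sdiff, Finset.mem_coe, YoungDiagram.mem_cells,
      YoungDiagram.mem_iff_lt_rowLen, Set.mem_singleton_iff, Prod.mk.injEq] at hab ⊢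
    have m1 := μ.rowLen_anti c a hle'.1
    refine ⟨by omega, fun hcd => ?_⟩
    rcases Nat.lt_or_ge i a with hia | hia
    · have := μ.rowLen_anti (i + 1) a hia
      omega
    · have : a = i := by omega
      subst this
      omega

/-- The condition on `k` is vacuous for `i = 0`: a box can always be added to the top row. -/
theorem addable_iff {μ : YoungDiagram} {i j : ℕ} :
    ((i, j) ∉ μ.cells ∧ IsLowerSet ((insert (i, j) μ.cells : Finset (ℕ × ℕ)) : Set (ℕ × ℕ))) ↔
      j = μ.rowLen i ∧ ∀ k, i = k + 1 → μ.rowLen i < μ.rowLen k := by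
  constructor
  · rintro ⟨h1, h2⟩
    rw [YoungDiagram.mem_cells, YoungDiagram.mem_iff_lt_rowLen] at h1
    have hmem : ((i, j) : ℕ × ℕ) ∈ ((insert (i, j) μ.cells : Finset (ℕ × ℕ)) : Set (ℕ × ℕ)) := by
      simp
    have hj : j = μ.rowLen i := by
      by_contra hne
      obtain ⟨k, rfl⟩ : ∃ k, j = k + 1 := ⟨j - 1, by omega⟩
      have := h2 (show ((i, k) : ℕ × ℕ) ≤ (i, k + 1) from ⟨le_rfl, Nat.le_succ _⟩) hmem
      simp [YoungDiagram.mem_iff_lt_rowLen] at this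
      omega
    refine ⟨hj, ?_⟩
    rintro k rfl
    have := h2 (show ((k, j) : ℕ × ℕ) ≤ (k + 1, j) from ⟨Nat.le_succ _, le_rfl⟩) hmem
    simp [YoungDiagram.mem_iff_lt_rowLen] at this
    omega
  · rintro ⟨h1, h2⟩
    refine ⟨by rw [YoungDiagram.mem_cells, YoungDiagram.mem_iff_lt_rowLen]; omega, ?_⟩
    rintro ⟨a, b⟩ ⟨c, d⟩ hle hab
    have hle' : c ≤ a ∧ d ≤ b := hle
    simp only [coe_insert, Set.mem_insert_iff, Finset.mem_coe, YoungDiagram.mem_cells,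
      YoungDiagram.mem_iff_lt_rowLen, Prod.mk.injEq] at hab ⊢
    have m1 := μ.rowLen_anti c a hle'.1
    rcases hab with ⟨rfl, rfl⟩ | hab
    · rcases Nat.lt_or_ge c a with hia | hia
      · obtain ⟨k, rfl⟩ : ∃ k, a = k + 1 := ⟨a - 1, by omega⟩
        have := h2 k rfl
        have := μ.rowLen_anti c k (by omega)
        omega
      · have : c = a := by omega
        subst this
        omega
    · omega

/-- A row below the top one accepts a box exactly when the row just above it ends in a corner. The
top row always accepts one, which accounts for the extra `1`. -/
theorem card_above {n : ℕ} (ρ : Par n) :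
    #{ν : Par (n + 1) | ρ.1 ≤ ν.1} = numCorners ρ.1 + 1 := by
  have h2 : ρ.1.cells.card = n := ρ.2
  set A : Set (ℕ × ℕ) := {c | c ∉ ρ.1.cells ∧
    IsLowerSet ((insert c ρ.1.cells : Finset (ℕ × ℕ)) : Set (ℕ × ℕ))} with hA
  have key : A.ncard = {ν : Par (n + 1) | ρ.1 ≤ ν.1}.ncard := by
    refine Set.ncard_congr (fun c hc => ⟨⟨insert c ρ.1.cells, hc.2⟩, ?_⟩) ?_ ?_ ?_
    · change (insert c ρ.1.cells).card = n + 1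
      rw [Finset.card_insert_of_notMem hc.1, h2]
    · intro c hc
      exact YoungDiagram.cells_subset_iff.mp (Finset.subset_insert _ _)
    · intro a b ha hb hab
      have := congrArg (fun x : Par (n + 1) => x.1.cells) hab
      have h3 : a ∈ insert b ρ.1.cells := by
        rw [← show insert a ρ.1.cells = insert b ρ.1.cells from this]
        exact Finset.mem_insert_self _ _
      exact (Finset.mem_insert.mp h3).resolve_right ha.1
    · intro ν hν
      obtain ⟨c, hc, hcc⟩ := exists_insert_cells hν
      refine ⟨c, ⟨hc, ?_⟩, ?_⟩
      · rw [hcc]; exact ν.1.isLowerSet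
      · exact Subtype.ext (YoungDiagram.ext hcc)
  have hfin : (corners ρ.1).Finite :=
    ρ.1.cells.finite_toSet.subset fun c hc => hc.1
  have hAi : A = insert (0, ρ.1.rowLen 0)
      ((fun c : ℕ × ℕ => (c.1 + 1, ρ.1.rowLen (c.1 + 1))) '' corners ρ.1) := by
    ext ⟨i, j⟩
    rw [hA, Set.mem_ofPred_eq, addable_iff, Set.mem_insert_iff, Set.mem_image]
    constructor
    · rintro ⟨rfl, h⟩
      rcases i with _ | k
      · exact Or.inl rfl
      · have := h k rfl
        exact Or.inr ⟨(k, ρ.1.rowLen k - 1), mem_corners_iff.mpr ⟨by omega, this⟩, rfl⟩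
    · rintro (h | ⟨⟨a, b⟩, hab, h⟩)
      · simp only [Prod.mk.injEq] at h
        obtain ⟨rfl, rfl⟩ := h
        exact ⟨rfl, fun k hk => by omega⟩
      · simp only [Prod.mk.injEq] at h
        obtain ⟨rfl, rfl⟩ := h
        refine ⟨rfl, fun k hk => ?_⟩
        obtain rfl : a = k := by omega
        exact (mem_corners_iff.mp hab).2
  have hcard : A.ncard = numCorners ρ.1 + 1 := by
    rw [hAi, Set.ncard_insert_of_notMem _ (hfin.image _), Set.InjOn.ncard_image]
    · rfl
    · rintro ⟨a, b⟩ ha ⟨c, d⟩ hc h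
      simp only [Prod.mk.injEq, Nat.add_right_cancel_iff] at h
      have h1 := mem_corners_iff.mp ha
      have h2 := mem_corners_iff.mp hc
      obtain ⟨rfl, -⟩ := h
      simp only [Prod.mk.injEq, true_and]
      omega
    · rintro ⟨c, -, h⟩
      simp at h
  rw [← hcard, key, Set.ncard_eq_toFinset_card']
  congr 1
  ext; simp

theorem card_inf_le {n : ℕ} {ν κ : Par (n + 1)} (h : ν ≠ κ) : (ν.1 ⊓ κ.1).cells.card ≤ n := by
  have h1 : ν.1.cells.card = n + 1 := ν.2
  have h2 : κ.1.cells.card = n + 1 := κ.2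
  by_contra hlt
  rw [YoungDiagram.cells_inf] at hlt
  have e1 := Finset.eq_of_subset_of_card_le (Finset.inter_subset_left (s₁ := ν.1.cells)
    (s₂ := κ.1.cells)) (by omega)
  have e2 := Finset.eq_of_subset_of_card_le (Finset.inter_subset_right (s₁ := ν.1.cells)
    (s₂ := κ.1.cells)) (by omega)
  exact h (Subtype.ext (YoungDiagram.ext (e1.symm.trans e2)))

/-- Distinct diagrams with `n + 1` boxes meet in at most `n`, so a common subdiagram with `n` boxes
must be the whole intersection. -/
theorem card_common_below {n : ℕ} {ν κ : Par (n + 1)} (h : ν ≠ κ) :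
    #{ρ : Par n | ρ.1 ≤ ν.1 ∧ ρ.1 ≤ κ.1} =
      if (ν.1.cells ∩ κ.1.cells).card = n then 1 else 0 := by
  have hle := card_inf_le h
  rw [YoungDiagram.cells_inf] at hle
  have aux : ∀ ρ : Par n, ρ.1 ≤ ν.1 ∧ ρ.1 ≤ κ.1 → ρ.1.cells = ν.1.cells ∩ κ.1.cells := by
    rintro ρ ⟨h1, h2⟩
    have h3 : ρ.1.cells.card = n := ρ.2
    exact Finset.eq_of_subset_of_card_le (Finset.subset_inter
      (YoungDiagram.cells_subset_iff.mpr h1) (YoungDiagram.cells_subset_iff.mpr h2)) (by omega)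
  split_ifs with hc
  · refine Finset.card_eq_one.mpr ⟨⟨ν.1 ⊓ κ.1, by rw [YoungDiagram.card, YoungDiagram.cells_inf, hc]⟩, ?_⟩
    ext ρ
    simp only [mem_filter, mem_univ, true_and, mem_singleton]
    constructor
    · intro hρ
      exact Subtype.ext (YoungDiagram.ext (by rw [aux ρ hρ, YoungDiagram.cells_inf]))
    · rintro rfl
      exact ⟨inf_le_left, inf_le_right⟩
  · refine Finset.card_eq_zero.mpr (Finset.filter_eq_empty_iff.mpr fun ρ _ hρ => hc ?_)
    rw [← aux ρ hρ]
    exact ρ.2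

/-- Dually, the only candidate is the union, which has `n + 2` boxes exactly when the intersection
has `n`. -/
theorem card_common_above {n : ℕ} {ν κ : Par (n + 1)} (h : ν ≠ κ) :
    #{τ : Par (n + 2) | ν.1 ≤ τ.1 ∧ κ.1 ≤ τ.1} =
      if (ν.1.cells ∩ κ.1.cells).card = n then 1 else 0 := by
  have hle := card_inf_le h
  have h1 : ν.1.cells.card = n + 1 := ν.2
  have h2 : κ.1.cells.card = n + 1 := κ.2
  rw [YoungDiagram.cells_inf] at hle
  have hui := Finset.card_union_add_card_inter ν.1.cells κ.1.cells
  have aux : ∀ τ : Par (n + 2), ν.1 ≤ τ.1 ∧ κ.1 ≤ τ.1 → ν.1.cells ∪ κ.1.cells = τ.1.cells := by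
    rintro τ ⟨h4, h5⟩
    have h3 : τ.1.cells.card = n + 2 := τ.2
    exact Finset.eq_of_subset_of_card_le (Finset.union_subset
      (YoungDiagram.cells_subset_iff.mpr h4) (YoungDiagram.cells_subset_iff.mpr h5)) (by omega)
  split_ifs with hc
  · refine Finset.card_eq_one.mpr
      ⟨⟨ν.1 ⊔ κ.1, by rw [YoungDiagram.card, YoungDiagram.cells_sup]; omega⟩, ?_⟩
    ext τ
    simp only [mem_filter, mem_univ, true_and, mem_singleton]
    constructor
    · intro hτ
      exact Subtype.ext (YoungDiagram.ext (by rw [← aux τ hτ, YoungDiagram.cells_sup]))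
    · rintro rfl
      exact ⟨le_sup_left, le_sup_right⟩
  · refine Finset.card_eq_zero.mpr (Finset.filter_eq_empty_iff.mpr fun τ _ hτ => hc ?_)
    have h3 : τ.1.cells.card = n + 2 := τ.2
    rw [← aux τ hτ] at h3
    omega

/-- The incidence function of Young's lattice. -/
noncomputable def inc {n : ℕ} (ρ : Par n) (ν : Par (n + 1)) : ℕ := if ρ.1 ≤ ν.1 then 1 else 0

theorem inc_mul_self {n : ℕ} (ρ : Par n) (ν : Par (n + 1)) : inc ρ ν * inc ρ ν = inc ρ ν := by
  unfold inc; split_ifs <;> rfl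

theorem sum_inc_left {n : ℕ} (ν : Par (n + 1)) : ∑ ρ : Par n, inc ρ ν = numCorners ν.1 := by
  rw [numCorners_eq_card, Finset.card_filter]; rfl

theorem sum_inc_right {n : ℕ} (ρ : Par n) : ∑ ν, inc ρ ν = numCorners ρ.1 + 1 := by
  rw [← card_above, Finset.card_filter]; rfl

theorem sum_inc_mul_inc_of_ne {n : ℕ} {ν κ : Par (n + 1)} (h : ν ≠ κ) :
    ∑ ρ : Par n, inc ρ ν * inc ρ κ = if (ν.1.cells ∩ κ.1.cells).card = n then 1 else 0 := by
  rw [← card_common_below h, Finset.card_filter]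
  refine Finset.sum_congr rfl fun ρ _ => ?_
  unfold inc
  by_cases h1 : ρ.1 ≤ ν.1 <;> by_cases h2 : ρ.1 ≤ κ.1 <;> simp [h1, h2]

/-- This is the relation `DU - UD = 1` for the up and down operators of Young's lattice. Off the
diagonal it pairs union with intersection; on the diagonal it says that there is one more addable
box than there are corners. -/
theorem sum_inc_mul_inc_comm {n : ℕ} (ν κ : Par (n + 1)) :
    ∑ τ : Par (n + 2), inc ν τ * inc κ τ =
      ∑ ρ : Par n, inc ρ ν * inc ρ κ + if ν = κ then 1 else 0 := by
  by_cases h : ν = κ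
  · subst h
    simp only [inc_mul_self, sum_inc_left, sum_inc_right, if_true]
  · rw [sum_inc_mul_inc_of_ne h, if_neg h, add_zero, ← card_common_above h, Finset.card_filter]
    refine Finset.sum_congr rfl fun ρ _ => ?_
    unfold inc
    by_cases h1 : ν.1 ≤ ρ.1 <;> by_cases h2 : κ.1 ≤ ρ.1 <;> simp [h1, h2]

instance subsingleton_par_zero : Subsingleton (Par 0) :=
  ⟨fun μ ν => Subtype.ext (YoungDiagram.ext
    ((Finset.card_eq_zero.mp μ.2).trans (Finset.card_eq_zero.mp ν.2).symm))⟩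

instance nonempty_par_zero : Nonempty (Par 0) := ⟨⟨⊥, by simp [YoungDiagram.card]⟩⟩

/-- The number of saturated chains from the empty diagram to `ν` in Young's lattice. -/
noncomputable def numChains : (n : ℕ) → Par n → ℕ
  | 0, _ => 1
  | n + 1, ν => ∑ ρ : Par n, inc ρ ν * numChains n ρ

/-- Commuting `D` past the `n + 1` factors of `U` in `D U^{n+1} ∅ = (n + 1) U^n ∅`. -/
theorem sum_inc_mul_numChains (n : ℕ) (ν : Par n) :
    ∑ τ, inc ν τ * numChains (n + 1) τ = (n + 1) * numChains n ν := by
  induction n with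
  | zero =>
    have h0 : numCorners ν.1 = 0 := by
      have : ν.1.cells = ∅ := Finset.card_eq_zero.mp ν.2
      simp [numCorners, corners, this]
    have hu : ∀ τ, ∑ ρ : Par 0, inc ρ τ * numChains 0 ρ = inc ν τ := fun τ => by
      rw [Fintype.sum_subsingleton _ ν]; simp [numChains]
    simp only [numChains] at hu ⊢
    simp only [hu, inc_mul_self, sum_inc_right, h0]
  | succ n ih =>
    calc ∑ τ, inc ν τ * numChains (n + 2) τ
        = ∑ τ, ∑ κ, inc ν τ * inc κ τ * numChains (n + 1) κ := by
          refine Finset.sum_congr rfl fun τ _ => ?_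
          rw [numChains, Finset.mul_sum]
          simp only [mul_assoc]
      _ = ∑ κ, (∑ τ, inc ν τ * inc κ τ) * numChains (n + 1) κ := by
          rw [Finset.sum_comm]
          simp only [Finset.sum_mul]
      _ = ∑ κ, (∑ ρ : Par n, inc ρ ν * inc ρ κ) * numChains (n + 1) κ + numChains (n + 1) ν := by
          simp only [sum_inc_mul_inc_comm, add_mul, Finset.sum_add_distrib, ite_mul, one_mul,
            zero_mul, Finset.sum_ite_eq, Finset.mem_univ, if_true]
      _ = ∑ ρ, inc ρ ν * ∑ κ, inc ρ κ * numChains (n + 1) κ + numChains (n + 1) ν := by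
          simp only [Finset.sum_mul, Finset.mul_sum]
          rw [Finset.sum_comm]
          simp only [mul_assoc]
      _ = (n + 1 + 1) * numChains (n + 1) ν := by
          simp only [ih]
          rw [numChains, Finset.mul_sum, ← Finset.sum_add_distrib]
          exact Finset.sum_congr rfl fun _ _ => by ring

theorem sum_numChains_sq (n : ℕ) : ∑ ν, numChains n ν ^ 2 = n.factorial := by
  induction n with
  | zero =>
    rw [Fintype.sum_subsingleton _ (Classical.arbitrary (Par 0))]; simp [numChains]
  | succ n ih =>
    have e : ∀ τ : Par (n + 1), numChains (n + 1) τ ^ 2 =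
        ∑ ν, numChains n ν * (inc ν τ * numChains (n + 1) τ) := fun τ => by
      rw [sq]; nth_rewrite 1 [numChains]; rw [Finset.sum_mul]
      exact Finset.sum_congr rfl fun _ _ => by ring
    simp only [e]
    rw [Finset.sum_comm]
    simp only [← Finset.mul_sum, sum_inc_mul_numChains]
    rw [Nat.factorial_succ, ← ih, Finset.mul_sum]
    exact Finset.sum_congr rfl fun _ _ => by ring

end Boxes

/-! ### Column antisymmetrizers -/

section Polytabloids
variable {α : Type*} {μ ν : YoungDiagram}

theorem Tableau.row_act (σ : Equiv.Perm α) (T : Tableau α μ) :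
    (Tableau.act σ T).row = T.row ∘ ⇑σ⁻¹ := rfl

theorem Tableau.col_act (σ : Equiv.Perm α) (T : Tableau α μ) :
    (Tableau.act σ T).col = T.col ∘ ⇑σ⁻¹ := rfl

theorem Tableau.act_mul (σ τ : Equiv.Perm α) (T : Tableau α μ) :
    Tableau.act (σ * τ) T = Tableau.act σ (Tableau.act τ T) := rfl

theorem Tableau.act_one (T : Tableau α μ) : Tableau.act 1 T = T := rfl

theorem Tableau.exists_act (T T' : Tableau α μ) : ∃ σ, T' = Tableau.act σ T :=
  ⟨T.symm.trans T', by ext c; simp [Tableau.act]⟩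

theorem Tableau.ext_row_col (T : Tableau α μ) {x y : α} (h1 : T.row x = T.row y)
    (h2 : T.col x = T.col y) : x = y :=
  T.symm.injective (Subtype.ext (Prod.ext h1 h2))

theorem Tableau.mem (T : Tableau α μ) (x : α) : (T.row x, T.col x) ∈ μ :=
  (YoungDiagram.mem_cells _).mp (T.symm x).2

theorem Tableau.exists_eq (T : Tableau α μ) {i j : ℕ} (h : (i, j) ∈ μ) :
    ∃ x, T.row x = i ∧ T.col x = j :=
  ⟨T ⟨(i, j), (YoungDiagram.mem_cells _).mpr h⟩, by simp [Tableau.row], by simp [Tableau.col]⟩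

theorem tabloidRep_single (σ : Equiv.Perm α) (f : α → ℕ) (a : ℂ) :
    tabloidRep α σ (Finsupp.single f a) = Finsupp.single (f ∘ ⇑σ⁻¹) a := by
  simp [tabloidRep]

variable [Fintype α] [DecidableEq α]

/-- The signed sum of the permutations that preserve every column of `T`. -/
noncomputable def colAntisymmetrizer (T : Tableau α μ) : ((α → ℕ) →₀ ℂ) →ₗ[ℂ] ((α → ℕ) →₀ ℂ) :=
  ∑ σ : Equiv.Perm α with ∀ x, T.col (σ x) = T.col x,
    ((Equiv.Perm.sign σ : ℤ) : ℂ) • tabloidRep α σ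

theorem colAntisymmetrizer_single_row (T : Tableau α μ) :
    colAntisymmetrizer T (Finsupp.single T.row 1) = polytabloid T := by
  simp [colAntisymmetrizer, polytabloid, tabloidRep_single, Tableau.row_act]

theorem sign_mul_self_cast (σ : Equiv.Perm α) :
    ((Equiv.Perm.sign σ : ℤ) : ℂ) * ((Equiv.Perm.sign σ : ℤ) : ℂ) = 1 := by
  rcases Int.units_eq_one_or (Equiv.Perm.sign σ) with h | h <;> simp [h]

theorem colAntisymmetrizer_apply_perm (T : Tableau α μ) {τ : Equiv.Perm α}
    (hτ : ∀ x, T.col (τ x) = T.col x) (v : (α → ℕ) →₀ ℂ) :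
    colAntisymmetrizer T (tabloidRep α τ v) =
      ((Equiv.Perm.sign τ : ℤ) : ℂ) • colAntisymmetrizer T v := by
  simp only [colAntisymmetrizer, LinearMap.sum_apply, LinearMap.smul_apply, Finset.smul_sum]
  refine Finset.sum_equiv (Equiv.mulRight τ) ?_ ?_
  · intro σ
    simp only [mem_filter, mem_univ, true_and, Equiv.coe_mulRight, Equiv.Perm.mul_apply]
    constructor
    · intro h x; rw [h, hτ]
    · intro h x
      obtain ⟨y, rfl⟩ := τ.surjective x
      rw [h, hτ]
  · intro σ _
    rw [Equiv.coe_mulRight, map_mul (tabloidRep α), Equiv.Perm.sign_mul, smul_smul,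
      Module.End.mul_apply]
    congr 1
    push_cast
    linear_combination (-(((Equiv.Perm.sign σ : ℤ) : ℂ))) * sign_mul_self_cast τ

theorem polytabloid_act (T : Tableau α μ) {τ : Equiv.Perm α}
    (hτ : ∀ x, T.col (τ x) = T.col x) :
    polytabloid (Tableau.act τ T) = ((Equiv.Perm.sign τ : ℤ) : ℂ) • polytabloid T := by
  rw [← tabloidRep_polytabloid, polytabloid]
  simp only [map_sum, tabloidRep_single, Finset.smul_sum]
  refine Finset.sum_equiv (Equiv.mulLeft τ) ?_ ?_
  · intro σ
    simp [hτ]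
  · intro σ _
    rw [Equiv.coe_mulLeft, Equiv.Perm.sign_mul, Finsupp.smul_single, Tableau.row_act,
      Tableau.row_act]
    congr 1
    rw [smul_eq_mul]
    push_cast
    linear_combination (-(((Equiv.Perm.sign σ : ℤ) : ℂ))) * sign_mul_self_cast τ

/-- The transposition of `x` and `y` fixes `f` but changes the sign of the antisymmetrizer. -/
theorem colAntisymmetrizer_single_eq_zero (T : Tableau α μ) {f : α → ℕ} {x y : α} (hxy : x ≠ y)
    (hf : f x = f y) (hc : T.col x = T.col y) (a : ℂ) :
    colAntisymmetrizer T (Finsupp.single f a) = 0 := by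
  have hsw : ∀ z, T.col (Equiv.swap x y z) = T.col z := fun z => by
    rw [Equiv.swap_apply_def]; split_ifs with h1 h2 <;> simp_all
  have h := colAntisymmetrizer_apply_perm T hsw (Finsupp.single f a)
  have hff : f ∘ ⇑(Equiv.swap x y)⁻¹ = f := by
    funext z
    rw [Equiv.swap_inv, Function.comp_apply, Equiv.swap_apply_def]
    split_ifs with h1 h2 <;> simp_all
  rw [tabloidRep_single, hff, Equiv.Perm.sign_swap hxy] at h
  simpa [self_eq_neg] using h

/-- Only the identity preserves every row and every column, so no other term contributes to this
coefficient. -/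
theorem polytabloid_apply_row (T : Tableau α μ) : polytabloid T T.row = 1 := by
  rw [polytabloid, Finsupp.finsetSum_apply, Finset.sum_eq_single 1]
  · simp [Tableau.act_one]
  · intro σ hσ h1
    rw [Finsupp.single_eq_of_ne]
    intro h
    refine h1 (Equiv.ext fun x => T.ext_row_col ?_ ?_)
    · have := congrFun h (σ x)
      simpa [Tableau.row_act] using this
    · exact (mem_filter.mp hσ).2 x
  · simp

theorem polytabloid_ne_zero (T : Tableau α μ) : polytabloid T ≠ 0 := fun h => by
  simpa [h] using polytabloid_apply_row T

/-- The number of boxes of `μ` in its first `k` rows. -/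
def rowsCard (μ : YoungDiagram) (k : ℕ) : ℕ := #{c ∈ μ.cells | c.1 < k}

theorem rowsCard_succ (μ : YoungDiagram) (k : ℕ) :
    rowsCard μ (k + 1) = rowsCard μ k + μ.rowLen k := by
  rw [YoungDiagram.rowLen_eq_card, rowsCard, rowsCard, YoungDiagram.row,
    ← Finset.card_union_of_disjoint]
  · congr 1
    ext c
    simp only [mem_filter, mem_union]
    have : c.1 < k + 1 ↔ c.1 < k ∨ c.1 = k := by omega
    rw [this]; tauto
  · rw [Finset.disjoint_left]
    intro c h1 h2
    have := (mem_filter.mp h1).2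
    have := (mem_filter.mp h2).2
    omega

theorem eq_of_rowsCard_eq (h : ∀ k, rowsCard μ k = rowsCard ν k) : μ = ν := by
  have hr : ∀ i, μ.rowLen i = ν.rowLen i := fun i => by
    have h1 := rowsCard_succ μ i
    have h2 := rowsCard_succ ν i
    rw [h, h, h2] at h1
    omega
  apply YoungDiagram.ext
  ext ⟨i, j⟩
  simp only [YoungDiagram.mem_cells, YoungDiagram.mem_iff_lt_rowLen, hr]

omit [DecidableEq α] in
theorem Tableau.card_row_lt (T : Tableau α μ) (k : ℕ) : #{x | T.row x < k} = rowsCard μ k := by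
  classical
  refine Finset.card_nbij (fun x => (T.row x, T.col x)) ?_ ?_ ?_
  · intro x hx
    exact mem_filter.mpr ⟨(YoungDiagram.mem_cells _).mpr (T.mem x), (mem_filter.mp hx).2⟩
  · intro x _ y _ h
    exact T.ext_row_col (Prod.ext_iff.mp h).1 (Prod.ext_iff.mp h).2
  · rintro ⟨i, j⟩ hc
    rw [Finset.mem_coe, mem_filter, YoungDiagram.mem_cells] at hc
    obtain ⟨x, rfl, rfl⟩ := T.exists_eq hc.1
    exact ⟨x, by simpa using hc.2, rfl⟩

omit [DecidableEq α] in
theorem Tableau.card_col_row_lt (T : Tableau α μ) (j k : ℕ) :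
    #{x | T.col x = j ∧ T.row x < k} = min k (μ.colLen j) := by
  classical
  rw [← Finset.card_range (min k (μ.colLen j))]
  refine Finset.card_nbij T.row ?_ ?_ ?_
  · intro x hx
    have hx' := (mem_filter.mp hx).2
    have := YoungDiagram.mem_iff_lt_colLen.mp (T.mem x)
    rw [hx'.1] at this
    simp [hx'.2, this]
  · intro x hx y hy h
    have hx' := (mem_filter.mp hx).2
    have hy' := (mem_filter.mp hy).2
    exact T.ext_row_col h (hx'.1.trans hy'.1.symm)
  · intro i hi
    simp only [coe_range, Set.mem_Iio, lt_min_iff] at hi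
    obtain ⟨x, h1, h2⟩ := T.exists_eq (YoungDiagram.mem_iff_lt_colLen.mpr hi.2)
    exact ⟨x, by simp [h1, h2, hi.1], h1⟩

-- If `f` is injective on each column of `T`, at most `min k (μ.colLen j)` labels of column `j` have
-- a value below `k`, and `T.row` attains this bound.
omit [DecidableEq α] in
theorem Tableau.card_col_lt_le (T : Tableau α μ) {f : α → ℕ}
    (hf : ∀ x y, f x = f y → T.col x = T.col y → x = y) (j k : ℕ) :
    #{x | T.col x = j ∧ f x < k} ≤ #{x | T.col x = j ∧ T.row x < k} := by
  classical
  rw [T.card_col_row_lt, le_min_iff]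
  constructor
  · conv_rhs => rw [← Finset.card_range k]
    refine Finset.card_le_card_of_injOn f ?_ ?_
    · intro x hx
      simp only [coe_filter, mem_univ, true_and, Set.mem_ofPred_eq] at hx
      simpa using hx.2
    · intro x hx y hy h
      simp only [coe_filter, mem_univ, true_and, Set.mem_ofPred_eq] at hx hy
      exact hf x y h (hx.1.trans hy.1.symm)
  · have h := T.card_col_row_lt j (μ.colLen j)
    rw [min_self] at h
    rw [← h]
    refine Finset.card_le_card fun x hx => ?_
    simp only [mem_filter, mem_univ, true_and] at hx ⊢
    have := YoungDiagram.mem_iff_lt_colLen.mp (T.mem x)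
    rw [hx.1] at this
    exact ⟨hx.1, this⟩

omit [DecidableEq α] in
theorem card_lt_eq_sum_col (T : Tableau α μ) (f : α → ℕ) (k : ℕ) :
    #{x | f x < k} = ∑ j ∈ univ.image T.col, #{x | T.col x = j ∧ f x < k} := by
  rw [Finset.card_eq_sum_card_fiberwise (f := T.col) (t := univ.image T.col)]
  · refine Finset.sum_congr rfl fun j _ => ?_
    rw [Finset.filter_filter]
    congr 1
    ext x
    simp [and_comm]
  · intro x _
    simp

-- The basic combinatorial lemma behind dominance: the column-wise bounds are summed over the
-- columns of `T`.
omit [DecidableEq α] in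
theorem rowsCard_le_of_injOn_col (T : Tableau α μ) (T' : Tableau α ν)
    (hf : ∀ x y, T'.row x = T'.row y → T.col x = T.col y → x = y) (k : ℕ) :
    rowsCard ν k ≤ rowsCard μ k := by
  rw [← T'.card_row_lt, ← T.card_row_lt, card_lt_eq_sum_col T, card_lt_eq_sum_col T T.row]
  exact Finset.sum_le_sum fun j _ => T.card_col_lt_le hf j k

-- For equal shapes the column-wise bounds sum to an equality, hence are all equalities. Each label
-- then has a `T'`-row that occurs in its own column of `T`, and can be moved there within the
-- column.
omit [DecidableEq α] in
theorem exists_perm_of_injOn_col (T T' : Tableau α μ)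
    (hf : ∀ x y, T'.row x = T'.row y → T.col x = T.col y → x = y) :
    ∃ σ : Equiv.Perm α, (∀ x, T.col (σ x) = T.col x) ∧ T'.row = T.row ∘ ⇑σ⁻¹ := by
  have hlt : ∀ x, T'.row x < μ.colLen (T.col x) := by
    intro x
    -- With `k` the full length of the column of `x`, equality says that every label of that column
    -- has `T'`-row below `k`.
    set k := μ.colLen (T.col x) with hk
    have hsum : ∑ j ∈ univ.image T.col, #{x | T.col x = j ∧ T'.row x < k} =
        ∑ j ∈ univ.image T.col, #{x | T.col x = j ∧ T.row x < k} := by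
      rw [← card_lt_eq_sum_col T, ← card_lt_eq_sum_col T, T'.card_row_lt, T.card_row_lt]
    have h := (Finset.sum_eq_sum_iff_of_le fun j _ => T.card_col_lt_le hf j k).mp hsum
      (T.col x) (by simp)
    have hsub : ({y | T.col y = T.col x ∧ T'.row y < k} : Finset α) ⊆
        ({y | T.col y = T.col x} : Finset α) := fun y hy => by
      simp only [mem_filter, mem_univ, true_and] at hy ⊢
      exact hy.1
    have hrow : ({y | T.col y = T.col x ∧ T.row y < k} : Finset α) =
        ({y | T.col y = T.col x} : Finset α) := by
      ext y
      simp only [mem_filter, mem_univ, true_and, and_iff_left_iff_imp]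
      intro hy
      have := YoungDiagram.mem_iff_lt_colLen.mp (T.mem y)
      rwa [hy] at this
    rw [hrow] at h
    have := Finset.eq_of_subset_of_card_le hsub h.ge
    have hx : x ∈ ({y | T.col y = T.col x} : Finset α) := by simp
    rw [← this] at hx
    exact (mem_filter.mp hx).2.2
  choose π h1 h2 using fun x => T.exists_eq (YoungDiagram.mem_iff_lt_colLen.mpr (hlt x))
  have hinj : Function.Injective π := fun x y h => by
    refine hf x y ?_ ?_
    · rw [← h1 x, ← h1 y, h]
    · rw [← h2 x, ← h2 y, h]
  let e : Equiv.Perm α := Equiv.ofBijective π (Finite.injective_iff_bijective.mp hinj)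
  refine ⟨e⁻¹, fun x => ?_, ?_⟩
  · have := h2 (e⁻¹ x)
    rw [show π (e⁻¹ x) = x from e.apply_symm_apply x] at this
    exact this.symm
  · rw [inv_inv]
    funext x
    exact (h1 x).symm

theorem specht_le_span (μ : YoungDiagram) : (specht α μ).toSubmodule ≤
    Submodule.span ℂ (Set.range fun T : Tableau α μ => Finsupp.single T.row (1 : ℂ)) := by
  change Submodule.span ℂ _ ≤ _
  rw [Submodule.span_le]
  rintro _ ⟨T, rfl⟩
  change polytabloid T ∈ _
  refine Submodule.sum_mem _ fun σ _ => ?_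
  rw [← mul_one ((Equiv.Perm.sign σ : ℤ) : ℂ), ← smul_eq_mul, ← Finsupp.smul_single]
  exact Submodule.smul_mem _ _ (Submodule.subset_span ⟨_, rfl⟩)

/-- On a tabloid of the same shape the antisymmetrizer gives either zero, if two labels share a row
and a column, or `± polytabloid T`. -/
theorem colAntisymmetrizer_mem_span (T : Tableau α μ) {v : (α → ℕ) →₀ ℂ}
    (hv : v ∈ (specht α μ).toSubmodule) : ∃ c : ℂ, colAntisymmetrizer T v = c • polytabloid T := by
  have hle : (specht α μ).toSubmodule ≤ (ℂ ∙ polytabloid T).comap (colAntisymmetrizer T) := by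
    refine (specht_le_span μ).trans (Submodule.span_le.mpr ?_)
    rintro _ ⟨T', rfl⟩
    rw [SetLike.mem_coe, Submodule.mem_comap]
    by_cases h : ∀ x y, T'.row x = T'.row y → T.col x = T.col y → x = y
    · obtain ⟨σ, h1, h2⟩ := exists_perm_of_injOn_col T T' h
      beta_reduce
      rw [h2, ← tabloidRep_single, colAntisymmetrizer_apply_perm T h1,
        colAntisymmetrizer_single_row]
      exact Submodule.smul_mem _ _ (Submodule.mem_span_singleton_self _)
    · push Not at h
      obtain ⟨x, y, h1, h2, h3⟩ := h
      rw [colAntisymmetrizer_single_eq_zero T h3 h1 h2]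
      exact Submodule.zero_mem _
  obtain ⟨c, hc⟩ := Submodule.mem_span_singleton.mp (hle hv)
  exact ⟨c, hc.symm⟩

theorem rowsCard_le_of_colAntisymmetrizer_ne_zero (T : Tableau α μ) {v : (α → ℕ) →₀ ℂ}
    (hv : v ∈ (specht α ν).toSubmodule) (h0 : colAntisymmetrizer T v ≠ 0) (k : ℕ) :
    rowsCard ν k ≤ rowsCard μ k := by
  by_contra hk
  refine h0 ?_
  have hle : (specht α ν).toSubmodule ≤ LinearMap.ker (colAntisymmetrizer T) := by
    refine (specht_le_span ν).trans (Submodule.span_le.mpr ?_)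
    rintro _ ⟨T', rfl⟩
    rw [SetLike.mem_coe, LinearMap.mem_ker]
    by_cases h : ∀ x y, T'.row x = T'.row y → T.col x = T.col y → x = y
    · exact absurd (rowsCard_le_of_injOn_col T T' h k) hk
    · push Not at h
      obtain ⟨x, y, h1, h2, h3⟩ := h
      exact colAntisymmetrizer_single_eq_zero T h3 h1 h2 _
  exact hle hv

end Polytabloids

/-! ### Homomorphisms between Specht modules -/

section Hom

/-- Maschke's averaging argument, applied to an arbitrary linear extension of `f`. -/
theorem exists_equivariant_extension {G V U : Type*} [Group G] [Fintype G] [AddCommGroup V]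
    [Module ℂ V] [AddCommGroup U] [Module ℂ U] (ρ : Representation ℂ G V) (W : Subrepresentation ρ)
    (τ : Representation ℂ G U) (f : Representation.IntertwiningMap W.toRepresentation τ) :
    ∃ F : V →ₗ[ℂ] U, (∀ g v, F (ρ g v) = τ g (F v)) ∧ ∀ w : W.toSubmodule, F w = f w := by
  obtain ⟨F₀, hF₀⟩ := f.toLinearMap.exists_extend
  have hF : ∀ w : W.toSubmodule, F₀ w = f w := fun w => LinearMap.congr_fun hF₀ w
  have hc : (Fintype.card G : ℂ) ≠ 0 := by simp
  refine ⟨(Fintype.card G : ℂ)⁻¹ • ∑ g : G, τ g⁻¹ ∘ₗ F₀ ∘ₗ ρ g, fun g v => ?_, fun w => ?_⟩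
  · simp only [LinearMap.smul_apply, LinearMap.sum_apply, LinearMap.comp_apply, map_smul, map_sum]
    congr 1
    refine Fintype.sum_equiv (Equiv.mulRight g) _ _ fun h => ?_
    simp only [Equiv.coe_mulRight, map_mul, Module.End.mul_apply, mul_inv_rev]
    rw [← Module.End.mul_apply (τ g), ← map_mul, mul_inv_cancel, map_one, Module.End.one_apply]
  · have : ∀ g : G, τ g⁻¹ (F₀ (ρ g w)) = f w := fun g => by
      have h1 : ρ g w = (W.toRepresentation g w : W.toSubmodule) := rfl
      rw [h1, hF, f.isIntertwining, ← Module.End.mul_apply, ← map_mul, inv_mul_cancel, map_one,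
        Module.End.one_apply]
    simp only [LinearMap.smul_apply, LinearMap.sum_apply, LinearMap.comp_apply, this,
      Finset.sum_const, Finset.card_univ]
    rw [← Nat.cast_smul_eq_nsmul ℂ, smul_smul, inv_mul_cancel₀ hc, one_smul]

variable {α : Type*} [Fintype α] [DecidableEq α] {μ ν : YoungDiagram}

/-- The polytabloid of `T` as an element of the Specht module. -/
noncomputable def spechtPolytabloid (T : Tableau α μ) : (specht α μ).toSubmodule :=
  ⟨polytabloid T, Submodule.subset_span ⟨T, rfl⟩⟩

theorem spechtPolytabloid_ne_zero (T : Tableau α μ) : spechtPolytabloid T ≠ 0 := fun h =>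
  polytabloid_ne_zero T (congrArg Subtype.val h)

theorem toRepresentation_spechtPolytabloid (σ : Equiv.Perm α) (T : Tableau α μ) :
    (specht α μ).toRepresentation σ (spechtPolytabloid T) =
      spechtPolytabloid (Tableau.act σ T) :=
  Subtype.ext (tabloidRep_polytabloid σ T)

theorem span_spechtPolytabloid :
    Submodule.span ℂ (Set.range (spechtPolytabloid : Tableau α μ → _)) = ⊤ := by
  have h := Submodule.span_span_coe_preimage (R := ℂ)
    (s := Set.range fun T : Tableau α μ => polytabloid T)
  refine top_le_iff.mp (h.ge.trans ?_)
  refine Submodule.span_mono ?_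
  rintro v ⟨T, hT⟩
  exact ⟨T, Subtype.ext hT⟩

theorem specht_hom_ext {U : Type*} [AddCommMonoid U] [Module ℂ U]
    {f g : (specht α μ).toSubmodule →ₗ[ℂ] U}
    (h : ∀ T, f (spechtPolytabloid T) = g (spechtPolytabloid T)) : f = g :=
  LinearMap.ext_on span_spechtPolytabloid (by rintro _ ⟨T, rfl⟩; exact h T)

/-- The polytabloid is the antisymmetrizer applied to the tabloid of `T`, which lies outside the
Specht module in general. An equivariant extension of `f` is defined on that tabloid and commutes
with the antisymmetrizer. -/
theorem intertwiningMap_apply_spechtPolytabloid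
    (f : Representation.IntertwiningMap (specht α μ).toRepresentation
      (specht α ν).toRepresentation) (T : Tableau α μ) :
    ∃ v ∈ (specht α ν).toSubmodule,
      (f (spechtPolytabloid T) : (α → ℕ) →₀ ℂ) = colAntisymmetrizer T v := by
  obtain ⟨F, h1, h2⟩ := exists_equivariant_extension (U := (specht α ν).toSubmodule) _ _ _ f
  refine ⟨F (Finsupp.single T.row 1), (F (Finsupp.single T.row 1)).2, ?_⟩
  rw [← h2]
  change ((F (polytabloid T) : (specht α ν).toSubmodule) : (α → ℕ) →₀ ℂ) = _
  rw [← colAntisymmetrizer_single_row]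
  simp only [colAntisymmetrizer, LinearMap.sum_apply, LinearMap.smul_apply, map_sum, map_smul, h1,
    Submodule.coe_sum, Submodule.coe_smul]
  rfl

theorem rowsCard_le_of_intertwiningMap_ne_zero
    {f : Representation.IntertwiningMap (specht α μ).toRepresentation
      (specht α ν).toRepresentation} (hf : f ≠ 0) (k : ℕ) : rowsCard ν k ≤ rowsCard μ k := by
  have : ∃ T : Tableau α μ, f (spechtPolytabloid T) ≠ 0 := by
    by_contra! h
    exact hf (Representation.IntertwiningMap.ext
      (specht_hom_ext (f := f.toLinearMap) (g := 0) h))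
  obtain ⟨T, hT⟩ := this
  obtain ⟨v, hv, h⟩ := intertwiningMap_apply_spechtPolytabloid f T
  refine rowsCard_le_of_colAntisymmetrizer_ne_zero T hv (fun h0 => hT ?_) k
  exact Subtype.ext (h.trans h0)

/-- A single polytabloid generates the module, and its image is a multiple of itself by
`colAntisymmetrizer_mem_span`. -/
theorem intertwiningMap_eq_smul [hne : Nonempty (Tableau α μ)]
    (f : Representation.IntertwiningMap (specht α μ).toRepresentation
      (specht α μ).toRepresentation) : ∃ c : ℂ, ∀ v, f v = c • v := by
  obtain ⟨T⟩ := hne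
  obtain ⟨v, hv, h⟩ := intertwiningMap_apply_spechtPolytabloid f T
  obtain ⟨c, hc⟩ := colAntisymmetrizer_mem_span T hv
  refine ⟨c, fun v => ?_⟩
  have hT : f (spechtPolytabloid T) = c • spechtPolytabloid T := Subtype.ext (h.trans hc)
  refine LinearMap.congr_fun (specht_hom_ext (f := f.toLinearMap) (g := c • LinearMap.id)
    fun T' => ?_) v
  obtain ⟨σ, rfl⟩ := T.exists_act T'
  rw [← toRepresentation_spechtPolytabloid]
  change f _ = c • _
  rw [f.isIntertwining, hT, map_smul]
  rfl

end Hom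

/-! ### The transposed Specht module -/

section Transpose

/-- The twist of a representation of a symmetric group by the sign character. -/
def signTwist {α V : Type*} [Fintype α] [DecidableEq α] [AddCommMonoid V] [Module ℂ V]
    (ρ : Representation ℂ (Equiv.Perm α) V) : Representation ℂ (Equiv.Perm α) V where
  toFun σ := ((Equiv.Perm.sign σ : ℤ) : ℂ) • ρ σ
  map_one' := by simp
  map_mul' σ τ := by
    rw [Equiv.Perm.sign_mul, map_mul, smul_mul_smul_comm]
    push_cast
    rfl

variable {α : Type*} {μ : YoungDiagram}

/-- The transposed tableau. -/
def Tableau.transpose (T : Tableau α μ) : Tableau α μ.transpose :=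
  ((Equiv.prodComm ℕ ℕ).subtypeEquiv fun c => by
    rw [YoungDiagram.mem_cells, YoungDiagram.mem_transpose, YoungDiagram.mem_cells]; rfl).trans T

theorem Tableau.row_transpose (T : Tableau α μ) : T.transpose.row = T.col := rfl

variable [Fintype α] [DecidableEq α]

/-- The sign of a tableau relative to a base tableau. -/
def Tableau.sgn (T₀ T : Tableau α μ) : ℂ := ((Equiv.Perm.sign (T₀.symm.trans T) : ℤ) : ℂ)

theorem Tableau.sgn_act (T₀ T : Tableau α μ) (σ : Equiv.Perm α) :
    T₀.sgn (Tableau.act σ T) = ((Equiv.Perm.sign σ : ℤ) : ℂ) * T₀.sgn T := by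
  have : T₀.symm.trans (Tableau.act σ T) = σ * T₀.symm.trans T := rfl
  rw [Tableau.sgn, this, Equiv.Perm.sign_mul]
  push_cast
  rfl

theorem Tableau.sgn_ne_zero (T₀ T : Tableau α μ) : T₀.sgn T ≠ 0 := by
  simp [Tableau.sgn]

open Classical in
/-- The signed sum of the polytabloids of the tableaux with prescribed columns. -/
noncomputable def columnSum (T₀ : Tableau α μ) (f : α → ℕ) : (specht α μ).toSubmodule :=
  ∑ T : Tableau α μ with T.col = f, T₀.sgn T • spechtPolytabloid T

theorem toRepresentation_columnSum (T₀ : Tableau α μ) (σ : Equiv.Perm α) (f : α → ℕ) :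
    columnSum T₀ (f ∘ ⇑σ⁻¹) =
      signTwist (specht α μ).toRepresentation σ (columnSum T₀ f) := by
  classical
  change _ = ((Equiv.Perm.sign σ : ℤ) : ℂ) • (specht α μ).toRepresentation σ _
  simp only [columnSum, map_sum, map_smul, toRepresentation_spechtPolytabloid, Finset.smul_sum,
    smul_smul]
  symm
  refine Finset.sum_bij (fun T _ => Tableau.act σ T) ?_ ?_ ?_ ?_
  · intro T hT
    simp only [mem_filter, mem_univ, true_and] at hT ⊢
    rw [Tableau.col_act, hT]
  · intro T _ T' _ h
    have := congrArg (Tableau.act σ⁻¹) h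
    rwa [← Tableau.act_mul, ← Tableau.act_mul, inv_mul_cancel] at this
  · intro T hT
    refine ⟨Tableau.act σ⁻¹ T, ?_, ?_⟩
    · simp only [mem_filter, mem_univ, true_and] at hT ⊢
      rw [Tableau.col_act, hT, inv_inv]
      funext x
      simp
    · rw [← Tableau.act_mul, mul_inv_cancel, Tableau.act_one]
  · intro T _
    rw [Tableau.sgn_act]

/-- Tableaux with the same columns differ by a column permutation, whose sign enters both `sgn` and
the polytabloid and cancels. All summands are therefore equal. -/
theorem columnSum_col (T₀ T : Tableau α μ) :
    ∃ c : ℂ, c ≠ 0 ∧ columnSum T₀ T.col = c • spechtPolytabloid T := by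
  classical
  have h : ∀ T' ∈ ({T' | T'.col = T.col} : Finset (Tableau α μ)),
      T₀.sgn T' • spechtPolytabloid T' = T₀.sgn T • spechtPolytabloid T := by
    intro T' hT'
    simp only [mem_filter, mem_univ, true_and] at hT'
    obtain ⟨σ, rfl⟩ := T.exists_act T'
    have hσ : ∀ x, T.col (σ x) = T.col x := fun x => by
      have := congrFun hT' (σ x)
      rw [← this, Tableau.col_act]
      simp
    have he : spechtPolytabloid (Tableau.act σ T) =
      ((Equiv.Perm.sign σ : ℤ) : ℂ) • spechtPolytabloid T := Subtype.ext (polytabloid_act T hσ)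
    rw [he, Tableau.sgn_act, smul_smul]
    congr 1
    linear_combination T₀.sgn T * sign_mul_self_cast σ
  refine ⟨#{T' : Tableau α μ | T'.col = T.col} * T₀.sgn T, ?_, ?_⟩
  · refine mul_ne_zero (Nat.cast_ne_zero.mpr (Finset.card_ne_zero.mpr ⟨T, ?_⟩))
      (T₀.sgn_ne_zero T)
    simp
  · rw [columnSum, Finset.sum_congr rfl h, Finset.sum_const, mul_smul, Nat.cast_smul_eq_nsmul]

/-- The map sends a row assignment `f` to `columnSum T f`, reading the rows of the transposed shape
as columns of `μ`. The polytabloid of the transposed tableau goes to a nonzero multiple of the sum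
of the polytabloids of `σ T` over the row permutations `σ` of `T`. Each of these has coefficient `1`
at the tabloid of `T`, so the sum does not vanish. -/
theorem exists_intertwiningMap_transpose (T : Tableau α μ) :
    ∃ f : Representation.IntertwiningMap (specht α μ.transpose).toRepresentation
      (signTwist (specht α μ).toRepresentation), f ≠ 0 := by
  classical
  let Φ : ((α → ℕ) →₀ ℂ) →ₗ[ℂ] (specht α μ).toSubmodule := Finsupp.linearCombination ℂ (columnSum T)
  have hs : ∀ f a, Φ (Finsupp.single f a) = a • columnSum T f := fun f a =>
    Finsupp.linearCombination_single ℂ a f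
  have hΦ : ∀ σ v, Φ (tabloidRep α σ v) = signTwist (specht α μ).toRepresentation σ (Φ v) := by
    intro σ v
    induction v using Finsupp.induction_linear with
    | zero => simp
    | add v w hv hw => simp only [map_add, hv, hw]
    | single f a => rw [tabloidRep_single, hs, hs, map_smul, toRepresentation_columnSum]
  let F : Representation.IntertwiningMap (specht α μ.transpose).toRepresentation
      (signTwist (specht α μ).toRepresentation) :=
    { toLinearMap := Φ ∘ₗ (specht α μ.transpose).toSubmodule.subtype
      isIntertwining' := fun σ => LinearMap.ext fun v => hΦ σ v }
  refine ⟨F, fun h0 => ?_⟩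
  have h1 : F (spechtPolytabloid T.transpose) = 0 := by rw [h0]; rfl
  have h2 : Φ (polytabloid T.transpose) = 0 := h1
  obtain ⟨c, hc, he⟩ := columnSum_col T T
  have h3 : Φ (polytabloid T.transpose) = c •
      ∑ σ : Equiv.Perm α with ∀ x, T.row (σ x) = T.row x,
        (specht α μ).toRepresentation σ (spechtPolytabloid T) := by
    rw [polytabloid, map_sum, Finset.smul_sum]
    refine Finset.sum_congr rfl fun σ _ => ?_
    rw [hs, Tableau.row_act, Tableau.row_transpose, toRepresentation_columnSum, he]
    change _ • (((Equiv.Perm.sign σ : ℤ) : ℂ) • (specht α μ).toRepresentation σ _) = _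
    rw [smul_smul, sign_mul_self_cast, one_smul, map_smul]
  have h4 : (∑ σ : Equiv.Perm α with ∀ x, T.row (σ x) = T.row x,
      (specht α μ).toRepresentation σ (spechtPolytabloid T)) = 0 :=
    (smul_eq_zero.mp (h3.symm.trans h2)).resolve_left hc
  rw [Finset.sum_congr rfl fun σ _ => toRepresentation_spechtPolytabloid σ T] at h4
  have h5 := congrArg (fun v : (specht α μ).toSubmodule => (v : (α → ℕ) →₀ ℂ) T.row) h4
  have h6 : ∀ σ ∈ ({σ : Equiv.Perm α | ∀ x, T.row (σ x) = T.row x} : Finset _),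
      (spechtPolytabloid (Tableau.act σ T) : (α → ℕ) →₀ ℂ) T.row = 1 := by
    intro σ hσ
    change polytabloid (Tableau.act σ T) T.row = 1
    rw [← polytabloid_apply_row (Tableau.act σ T)]
    congr 1
    funext x
    rw [Tableau.row_act, Function.comp_apply, ← (mem_filter.mp hσ).2 (σ⁻¹ x)]
    simp
  simp only [Submodule.coe_sum, Finsupp.finsetSum_apply] at h5
  rw [Finset.sum_congr rfl h6] at h5
  simp only [sum_const, nsmul_eq_mul, mul_one, ZeroMemClass.coe_zero, Finsupp.coe_zero,
    Pi.zero_apply, Nat.cast_eq_zero] at h5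
  rw [Finset.card_eq_zero] at h5
  have : (1 : Equiv.Perm α) ∈ ({σ : Equiv.Perm α | ∀ x, T.row (σ x) = T.row x} : Finset _) := by
    simp
  rw [h5] at this
  simp at this

end Transpose

/-! ### Restriction to a smaller symmetric group -/

section Branching

/-- The embedding of `S_n` into `S_{n+1}` as the stabilizer of `0`. -/
def permSucc (n : ℕ) : Equiv.Perm (Fin n) →* Equiv.Perm (Fin (n + 1)) where
  toFun σ := Equiv.Perm.decomposeFin.symm (0, σ)
  map_one' := by
    ext x
    refine Fin.cases ?_ (fun x => ?_) x <;> simp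
  map_mul' σ τ := by
    ext x
    refine Fin.cases ?_ (fun x => ?_) x <;> simp

theorem permSucc_apply_zero {n : ℕ} (σ : Equiv.Perm (Fin n)) : permSucc n σ 0 = 0 := by
  simp [permSucc]

theorem permSucc_apply_succ {n : ℕ} (σ : Equiv.Perm (Fin n)) (x : Fin n) :
    permSucc n σ x.succ = (σ x).succ := by
  simp [permSucc]

theorem sign_permSucc {n : ℕ} (σ : Equiv.Perm (Fin n)) :
    Equiv.Perm.sign (permSucc n σ) = Equiv.Perm.sign σ := by
  simp [permSucc]

theorem sum_perm_fin_succ {n : ℕ} {M : Type*} [AddCommMonoid M]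
    (F : Equiv.Perm (Fin (n + 1)) → M) (hF : ∀ σ, σ 0 ≠ 0 → F σ = 0) :
    ∑ σ, F σ = ∑ τ, F (permSucc n τ) := by
  rw [← Equiv.sum_comp Equiv.Perm.decomposeFin.symm, Fintype.sum_prod_type,
    Finset.sum_eq_single 0]
  · rfl
  · intro p _ hp
    exact Finset.sum_eq_zero fun τ _ => hF _ (by simpa using hp)
  · simp

/-- The map that deletes the label `0` if it lies in row `r`, and is zero otherwise. -/
noncomputable def removeZero (n r : ℕ) : ((Fin (n + 1) → ℕ) →₀ ℂ) →ₗ[ℂ] ((Fin n → ℕ) →₀ ℂ) :=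
  Finsupp.linearCombination ℂ fun f =>
    if f 0 = r then Finsupp.single (f ∘ Fin.succ) (1 : ℂ) else 0

theorem removeZero_single {n r : ℕ} (f : Fin (n + 1) → ℕ) (a : ℂ) :
    removeZero n r (Finsupp.single f a) =
      if f 0 = r then Finsupp.single (f ∘ Fin.succ) a else 0 := by
  rw [removeZero, Finsupp.linearCombination_single]
  split_ifs <;> simp

theorem removeZero_tabloidRep {n r : ℕ} (σ : Equiv.Perm (Fin n)) (v : (Fin (n + 1) → ℕ) →₀ ℂ) :
    removeZero n r (tabloidRep _ (permSucc n σ) v) = tabloidRep _ σ (removeZero n r v) := by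
  induction v using Finsupp.induction_linear with
  | zero => simp
  | add v w hv hw => simp only [map_add, hv, hw]
  | single f a =>
    rw [tabloidRep_single, removeZero_single, removeZero_single, ← map_inv, Function.comp_apply,
      permSucc_apply_zero]
    split_ifs
    · rw [tabloidRep_single]
      congr 1
    · rw [map_zero]

/-- A column permutation that leaves the label `0` in its row fixes it, so the surviving terms are
indexed by the column permutations of the smaller tableau. -/
theorem removeZero_polytabloid {n : ℕ} {ρ ν : YoungDiagram} (T : Tableau (Fin n) ρ)
    (S : Tableau (Fin (n + 1)) ν) (hr : ∀ x, S.row (Fin.succ x) = T.row x)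
    (hc : ∀ x, S.col (Fin.succ x) = T.col x) :
    removeZero n (S.row 0) (polytabloid S) = polytabloid T := by
  rw [polytabloid, polytabloid, map_sum, Finset.sum_filter, Finset.sum_filter, sum_perm_fin_succ]
  · refine Finset.sum_congr rfl fun τ _ => ?_
    have : (∀ x, S.col (permSucc n τ x) = S.col x) ↔ ∀ x, T.col (τ x) = T.col x := by
      rw [Fin.forall_fin_succ]
      simp [permSucc_apply_zero, permSucc_apply_succ, hc]
    by_cases h : ∀ x, T.col (τ x) = T.col x
    · rw [if_pos (this.mpr h), if_pos h, removeZero_single, sign_permSucc, Tableau.row_act, ← map_inv, Function.comp_apply,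
        permSucc_apply_zero, if_pos rfl]
      congr 1
      funext x
      simp only [Function.comp_apply, permSucc_apply_succ, hr, Tableau.row_act]
    · rw [if_neg (mt this.mp h), if_neg h]
  · intro σ h0
    split_ifs with h
    · rw [removeZero_single, if_neg]
      intro h1
      rw [Tableau.row_act, Function.comp_apply] at h1
      have h2 := h (σ⁻¹ 0)
      rw [show σ (σ⁻¹ 0) = 0 from σ.apply_symm_apply 0] at h2
      have h3 := S.ext_row_col h1 h2.symm
      exact h0 (by nth_rewrite 1 [← h3]; exact σ.apply_symm_apply 0)
    · rfl

theorem exists_tableau_succ {n : ℕ} {ρ ν : YoungDiagram} {c : ℕ × ℕ} (hc : c ∉ ρ.cells)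
    (hcν : insert c ρ.cells = ν.cells) (T : Tableau (Fin n) ρ) :
    ∃ S : Tableau (Fin (n + 1)) ν, (∀ x, S.row (Fin.succ x) = T.row x) ∧
      ∀ x, S.col (Fin.succ x) = T.col x := by
  let e : {a // a ∈ ν.cells} ≃ {a // a ∈ insert c ρ.cells} :=
    Equiv.subtypeEquivRight fun a => by rw [hcν]
  let S : Tableau (Fin (n + 1)) ν :=
    (e.trans (Finset.subtypeInsertEquivOption hc)).trans
      ((Equiv.optionCongr T).trans (finSuccEquiv n).symm)
  have hS : ∀ x : Fin n, (S.symm x.succ).1 = (T.symm x).1 := fun x => by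
    simp [S, e, Finset.subtypeInsertEquivOption]
    rfl
  exact ⟨S, fun x => congrArg Prod.fst (hS x), fun x => congrArg Prod.snd (hS x)⟩

theorem nonempty_tableau {n : ℕ} (μ : Par n) : Nonempty (Tableau (Fin n) μ.1) :=
  ⟨Fintype.equivOfCardEq (by rw [Fintype.card_coe, Fintype.card_fin]; exact μ.2)⟩

theorem exists_intertwiningMap_restrict {n : ℕ} {ρ : Par n} {ν : Par (n + 1)}
    (h : ρ.1 ≤ ν.1) :
    ∃ f : Representation.IntertwiningMap
      ((specht (Fin (n + 1)) ν.1).toRepresentation.comp (permSucc n))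
      (specht (Fin n) ρ.1).toRepresentation, f ≠ 0 := by
  obtain ⟨c, hc, hcν⟩ := exists_insert_cells h
  obtain ⟨T⟩ := nonempty_tableau ρ
  obtain ⟨S, hr, hcol⟩ := exists_tableau_succ hc hcν T
  -- `removeZero` need not send all of `S^ν` into `S^ρ`, so it is followed by an equivariant
  -- projection onto `S^ρ`.
  obtain ⟨P, hP, hP'⟩ := exists_equivariant_extension (U := (specht (Fin n) ρ.1).toSubmodule) _
    (specht (Fin n) ρ.1) _ (Representation.IntertwiningMap.id _)
  let F : Representation.IntertwiningMap
      ((specht (Fin (n + 1)) ν.1).toRepresentation.comp (permSucc n))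
      (specht (Fin n) ρ.1).toRepresentation :=
    { toLinearMap := P ∘ₗ removeZero n (S.row 0) ∘ₗ (specht (Fin (n + 1)) ν.1).toSubmodule.subtype
      isIntertwining' := fun σ => LinearMap.ext fun v =>
        (congrArg P (removeZero_tabloidRep σ v.1)).trans (hP σ _) }
  refine ⟨F, fun h0 => ?_⟩
  have h1 : F (spechtPolytabloid S) = 0 := by rw [h0]; rfl
  have h2 : P (removeZero n (S.row 0) (polytabloid S)) = 0 := h1
  rw [removeZero_polytabloid T S hr hcol] at h2
  exact spechtPolytabloid_ne_zero T ((hP' (spechtPolytabloid T)).symm.trans h2)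

end Branching

open ComplexConjugate

/-! ### Characters -/

section InnerProduct

section Pairing
variable {G : Type*} [Fintype G]

/-- The averaged bilinear pairing of functions on a finite group. -/
noncomputable def ip (φ ψ : G → ℂ) : ℂ := (Nat.card G : ℂ)⁻¹ * ∑ g, φ g * ψ g

theorem ip_comm (φ ψ : G → ℂ) : ip φ ψ = ip ψ φ := by
  simp only [ip, mul_comm]

theorem ip_sub_left (φ ψ χ : G → ℂ) : ip (φ - ψ) χ = ip φ χ - ip ψ χ := by
  simp only [ip, Pi.sub_apply, sub_mul, Finset.sum_sub_distrib, mul_sub]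

theorem ip_sub_right (φ ψ χ : G → ℂ) : ip χ (φ - ψ) = ip χ φ - ip χ ψ := by
  rw [ip_comm, ip_sub_left, ip_comm φ, ip_comm ψ]

theorem ip_sum_left {ι : Type*} (s : Finset ι) (a : ι → ℂ) (φ : ι → G → ℂ) (χ : G → ℂ) :
    ip (∑ i ∈ s, a i • φ i) χ = ∑ i ∈ s, a i * ip (φ i) χ := by
  simp only [ip, Finset.sum_apply, Pi.smul_apply, smul_eq_mul, Finset.sum_mul, Finset.mul_sum]
  rw [Finset.sum_comm]
  exact Finset.sum_congr rfl fun _ _ => Finset.sum_congr rfl fun _ _ => by ring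

theorem ip_sum_right {ι : Type*} (s : Finset ι) (a : ι → ℂ) (φ : ι → G → ℂ) (χ : G → ℂ) :
    ip χ (∑ i ∈ s, a i • φ i) = ∑ i ∈ s, a i * ip χ (φ i) := by
  rw [ip_comm, ip_sum_left]
  simp only [ip_comm χ]

theorem card_cast_ne_zero [Nonempty G] : (Nat.card G : ℂ) ≠ 0 := Nat.cast_ne_zero.mpr Nat.card_pos.ne'

/-- The pairing has no conjugation, so it is positive definite only on real-valued functions; hence
the need for `conj_irrChar`. -/
theorem ip_self_of_real {φ : G → ℂ} (h : ∀ g, conj (φ g) = φ g) :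
    ip φ φ = (((Nat.card G : ℝ)⁻¹ * ∑ g, (φ g).re ^ 2 : ℝ) : ℂ) := by
  rw [ip]
  push_cast
  congr 1
  refine Finset.sum_congr rfl fun g _ => ?_
  rw [Complex.conj_eq_iff_re.mp (h g), sq]

theorem ip_self_re_nonneg {φ : G → ℂ} (h : ∀ g, conj (φ g) = φ g) : 0 ≤ (ip φ φ).re := by
  rw [ip_self_of_real h, Complex.ofReal_re]
  positivity

theorem eq_zero_of_ip_self_re_nonpos [Nonempty G] {φ : G → ℂ} (h : ∀ g, conj (φ g) = φ g)
    (h0 : (ip φ φ).re ≤ 0) : φ = 0 := by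
  rw [ip_self_of_real h, Complex.ofReal_re] at h0
  have hc : (0 : ℝ) < (Nat.card G : ℝ)⁻¹ := by
    have : 0 < Nat.card G := Nat.card_pos
    positivity
  have hs : ∑ g, (φ g).re ^ 2 = 0 :=
    le_antisymm (by
      by_contra hlt
      exact absurd h0 (not_le.mpr (mul_pos hc (not_le.mp hlt)))) (by positivity)
  funext g
  have := (Finset.sum_eq_zero_iff_of_nonneg fun g _ => sq_nonneg (φ g).re).mp hs g (mem_univ g)
  rw [← Complex.conj_eq_iff_re.mp (h g), pow_eq_zero_iff two_ne_zero |>.mp this]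
  rfl

end Pairing

variable {G : Type*} [Group G] [Fintype G]

/-- The character of the regular representation. -/
noncomputable def regChar (G : Type*) [Group G] [Fintype G] : G → ℂ :=
  open Classical in fun g => if g = 1 then (Nat.card G : ℂ) else 0

theorem ip_regChar (φ : G → ℂ) : ip (regChar G) φ = φ 1 := by
  have : (Nat.card G : ℂ) ≠ 0 := card_cast_ne_zero
  rw [ip, Finset.sum_eq_single 1]
  · rw [regChar, if_pos rfl, inv_mul_cancel_left₀ this]
  · intro g _ hg
    rw [regChar, if_neg hg, zero_mul]
  · simp

section Representation
variable {V W : Type*} [AddCommGroup V] [Module ℂ V] [FiniteDimensional ℂ V] [AddCommGroup W]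
  [Module ℂ W] [FiniteDimensional ℂ W] (ρ : Representation ℂ G V) (σ : Representation ℂ G W)

theorem ip_character (h : ∀ g, ρ.character g⁻¹ = ρ.character g) :
    ip ρ.character σ.character = Module.finrank ℂ (Representation.IntertwiningMap ρ σ) := by
  have : Invertible (Nat.card G : ℂ) := invertibleOfNonzero card_cast_ne_zero
  rw [← Representation.card_inv_mul_sum_char_mul_char_eq_finrank, ip]
  simp only [h, mul_comm]

theorem exists_ip_character_eq (h : ∀ g, ρ.character g⁻¹ = ρ.character g)
    (hf : ∃ f : Representation.IntertwiningMap ρ σ, f ≠ 0) :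
    ∃ m : ℕ, 1 ≤ m ∧ ip ρ.character σ.character = m := by
  refine ⟨_, ?_, ip_character ρ σ h⟩
  obtain ⟨f, hf⟩ := hf
  have : Module.Finite ℂ (Representation.IntertwiningMap ρ σ) :=
    Module.Finite.equiv (Representation.invariantsEquivIntertwiningMap ρ σ)
  have : Nontrivial (Representation.IntertwiningMap ρ σ) := ⟨f, 0, hf⟩
  exact Module.finrank_pos

omit [Fintype G] [FiniteDimensional ℂ V] in
theorem finrank_intertwiningMap_self {v : V} (hv : v ≠ 0)
    (h : ∀ f : Representation.IntertwiningMap ρ ρ, ∃ c : ℂ, ∀ v, f v = c • v) :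
    Module.finrank ℂ (Representation.IntertwiningMap ρ ρ) = 1 := by
  refine finrank_eq_one (Representation.IntertwiningMap.id ρ) (fun h0 => hv ?_) fun f => ?_
  · exact congrArg (fun f : Representation.IntertwiningMap ρ ρ => f v) h0
  · obtain ⟨c, hc⟩ := h f
    exact ⟨c, Representation.IntertwiningMap.ext (LinearMap.ext fun v => (hc v).symm)⟩

end Representation

end InnerProduct

/-! ### Characters of Specht modules: orthonormality, completeness and branching. -/

section SpechtCharacters

theorem irrChar_eq_character {n : ℕ} (μ : Par n) :
    irrChar μ = Representation.character (V := (specht (Fin n) μ.1).toSubmodule)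
      (specht (Fin n) μ.1).toRepresentation := rfl

theorem irrChar_conj {n : ℕ} (μ : Par n) (τ σ : Equiv.Perm (Fin n)) :
    irrChar μ (τ * σ * τ⁻¹) = irrChar μ σ :=
  Representation.char_conj (V := (specht (Fin n) μ.1).toSubmodule) _ _ _

theorem irrChar_inv {n : ℕ} (μ : Par n) (σ : Equiv.Perm (Fin n)) :
    irrChar μ σ⁻¹ = irrChar μ σ := by
  obtain ⟨τ, hτ⟩ := isConj_iff.mp ((Equiv.Perm.isConj_iff_cycleType_eq).mpr
    (Equiv.Perm.cycleType_inv σ).symm)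
  rw [← hτ, irrChar_conj]

theorem conj_polytabloid {α : Type*} [Fintype α] [DecidableEq α] {μ : YoungDiagram}
    (T : Tableau α μ) (f : α → ℕ) : conj (polytabloid T f) = polytabloid T f := by
  simp only [polytabloid, Finsupp.finsetSum_apply, map_sum]
  refine Finset.sum_congr rfl fun σ _ => ?_
  rw [Finsupp.single_apply]
  split_ifs <;> simp

/-- Polytabloids have real coefficients and are permuted by the group, so in a basis of polytabloids
the matrices are real. -/
theorem conj_irrChar {n : ℕ} (μ : Par n) (σ : Equiv.Perm (Fin n)) :
    conj (irrChar μ σ) = irrChar μ σ := by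
  classical
  let b := Module.Basis.ofSpan (V := (specht (Fin n) μ.1).toSubmodule)
    (span_spechtPolytabloid (α := Fin n) (μ := μ.1)).ge
  have hb : ∀ i, ∃ T, b i = spechtPolytabloid T := fun i => by
    obtain ⟨T, hT⟩ := Module.Basis.ofSpan_subset (V := (specht (Fin n) μ.1).toSubmodule)
      (span_spechtPolytabloid (α := Fin n) (μ := μ.1)).ge (Set.mem_range_self i)
    exact ⟨T, hT.symm⟩
  have := Module.Finite.finite_basis b
  let _ := Fintype.ofFinite
    ((linearIndepOn_empty ℂ id).extend (Set.empty_subset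
      (Set.range (spechtPolytabloid : Tableau (Fin n) μ.1 → _))))
  have hreal : ∀ (T : Tableau (Fin n) μ.1) i,
      conj (b.repr (spechtPolytabloid T) i) = b.repr (spechtPolytabloid T) i := by
    intro T i
    have h1 := b.sum_repr (spechtPolytabloid T)
    -- The conjugated coordinates expand the same real vector, so they agree with the original ones
    -- by uniqueness.
    have h2 : ∑ j, conj (b.repr (spechtPolytabloid T) j) • b j = spechtPolytabloid T := by
      refine Subtype.ext (Finsupp.ext fun f => ?_)
      have h3 := congrArg (fun v : (specht (Fin n) μ.1).toSubmodule =>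
        conj ((v : (Fin n → ℕ) →₀ ℂ) f)) h1
      simp only [Submodule.coe_sum, Submodule.coe_smul, Finsupp.finsetSum_apply, map_sum,
        Finsupp.smul_apply, smul_eq_mul, map_mul] at h3 ⊢
      have h4 : ∀ T : Tableau (Fin n) μ.1, conj ((spechtPolytabloid T : (Fin n → ℕ) →₀ ℂ) f) =
          (spechtPolytabloid T : (Fin n → ℕ) →₀ ℂ) f := fun T => conj_polytabloid T f
      rw [h4] at h3
      rw [← h3]
      refine Finset.sum_congr rfl fun j _ => ?_
      obtain ⟨S, hS⟩ := hb j
      rw [hS, h4]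
    have h5 := congrArg (fun v => b.repr v i) h2
    exact (congrFun (b.repr_sum_self fun j => conj (b.repr (spechtPolytabloid T) j)) i).symm.trans h5
  rw [irrChar, LinearMap.trace_eq_matrix_trace ℂ b, Matrix.trace, map_sum]
  refine Finset.sum_congr rfl fun i _ => ?_
  rw [Matrix.diag_apply, LinearMap.toMatrix_apply]
  obtain ⟨S, hS⟩ := hb i
  rw [hS, toRepresentation_spechtPolytabloid, hreal]

theorem nat_card_perm_fin (n : ℕ) : Nat.card (Equiv.Perm (Fin n)) = n.factorial := by
  rw [Nat.card_eq_fintype_card, Fintype.card_perm, Fintype.card_fin]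

theorem ip_irrChar_self {n : ℕ} (μ : Par n) : ip (irrChar μ) (irrChar μ) = 1 := by
  obtain ⟨T⟩ := nonempty_tableau μ
  rw [irrChar_eq_character, ip_character (V := (specht (Fin n) μ.1).toSubmodule)
    (W := (specht (Fin n) μ.1).toSubmodule) _ _ (irrChar_inv μ), Nat.cast_eq_one]
  refine finrank_intertwiningMap_self (V := (specht (Fin n) μ.1).toSubmodule) _
    (spechtPolytabloid_ne_zero T) fun f => ?_
  exact intertwiningMap_eq_smul (hne := ⟨T⟩) f

/-- A nonzero pairing would give nonzero intertwiners in both directions, hence dominance both ways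
and equal shapes. -/
theorem ip_irrChar_of_ne {n : ℕ} {μ ν : Par n} (h : μ ≠ ν) : ip (irrChar μ) (irrChar ν) = 0 := by
  by_contra h0
  have key : ∀ μ ν : Par n, ip (irrChar μ) (irrChar ν) ≠ 0 → ∀ k,
      rowsCard ν.1 k ≤ rowsCard μ.1 k := by
    intro μ ν h0 k
    rw [irrChar_eq_character, irrChar_eq_character, ip_character
      (V := (specht (Fin n) μ.1).toSubmodule) (W := (specht (Fin n) ν.1).toSubmodule) _ _
      (irrChar_inv μ)] at h0
    obtain ⟨f, hf⟩ : ∃ f : Representation.IntertwiningMap (specht (Fin n) μ.1).toRepresentation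
        (specht (Fin n) ν.1).toRepresentation, f ≠ 0 := by
      by_contra! hall
      have : Subsingleton (Representation.IntertwiningMap (specht (Fin n) μ.1).toRepresentation
        (specht (Fin n) ν.1).toRepresentation) := ⟨fun f g => (hall f).trans (hall g).symm⟩
      exact h0 (by rw [Module.finrank_zero_of_subsingleton, Nat.cast_zero])
    exact rowsCard_le_of_intertwiningMap_ne_zero hf k
  refine h (Subtype.ext (eq_of_rowsCard_eq fun k => le_antisymm ?_ (key μ ν h0 k)))
  exact key ν μ (by rwa [ip_comm]) k

open Classical in
theorem ip_irrChar {n : ℕ} (μ ν : Par n) :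
    ip (irrChar μ) (irrChar ν) = if μ = ν then 1 else 0 := by
  split_ifs with h
  · rw [h, ip_irrChar_self]
  · exact ip_irrChar_of_ne h

/-- The sign character with complex values. -/
noncomputable def signChar (n : ℕ) (σ : Equiv.Perm (Fin n)) : ℂ := ((Equiv.Perm.sign σ : ℤ) : ℂ)

theorem signChar_mul_self {n : ℕ} (σ : Equiv.Perm (Fin n)) : signChar n σ * signChar n σ = 1 :=
  sign_mul_self_cast σ

theorem conj_signChar {n : ℕ} (σ : Equiv.Perm (Fin n)) : conj (signChar n σ) = signChar n σ := by
  simp [signChar]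

theorem signChar_conj {n : ℕ} (τ σ : Equiv.Perm (Fin n)) :
    signChar n (τ * σ * τ⁻¹) = signChar n σ := by
  simp only [signChar, Equiv.Perm.sign_mul, Equiv.Perm.sign_inv, Units.val_mul, Int.cast_mul]
  linear_combination ((Equiv.Perm.sign σ : ℤ) : ℂ) * sign_mul_self_cast τ

/-- Both sides are real of norm `1`, and the nonzero intertwiner makes their pairing at least `1`;
so their difference has norm at most `0`. -/
theorem irrChar_transpose {n : ℕ} (μ : Par n) :
    irrChar μ.transpose = signChar n * irrChar μ := by
  obtain ⟨T⟩ := nonempty_tableau μ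
  obtain ⟨m, hm, h⟩ := exists_ip_character_eq
    (V := (specht (Fin n) μ.transpose.1).toSubmodule) (W := (specht (Fin n) μ.1).toSubmodule) _ _
    (irrChar_inv μ.transpose)
    (exists_intertwiningMap_transpose T)
  have hs : Representation.character (V := (specht (Fin n) μ.1).toSubmodule)
      (signTwist (specht (Fin n) μ.1).toRepresentation) =
      signChar n * irrChar μ := by
    funext σ
    exact (map_smul (LinearMap.trace ℂ _) _ _)
  rw [hs] at h
  change ip (irrChar μ.transpose) _ = _ at h
  have hss : ip (signChar n * irrChar μ) (signChar n * irrChar μ) = 1 := by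
    rw [← ip_irrChar_self μ, ip, ip]
    congr 1
    refine Finset.sum_congr rfl fun σ _ => ?_
    simp only [Pi.mul_apply]
    linear_combination irrChar μ σ * irrChar μ σ * signChar_mul_self σ
  refine sub_eq_zero.mp (eq_zero_of_ip_self_re_nonpos (fun σ => ?_) ?_)
  · simp only [Pi.sub_apply, Pi.mul_apply, map_sub, map_mul, conj_irrChar, conj_signChar]
  · rw [ip_sub_left, ip_sub_right, ip_sub_right, ip_irrChar_self, hss,
      ip_comm (signChar n * irrChar μ), h]
    have : (1 : ℝ) ≤ m := by exact_mod_cast hm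
    simp
    linarith

/-- The degree of the character labelled by `μ`. -/
noncomputable def degree {n : ℕ} (μ : Par n) : ℕ :=
  Module.finrank ℂ (specht (Fin n) μ.1).toSubmodule

theorem irrChar_one {n : ℕ} (μ : Par n) : irrChar μ 1 = degree μ :=
  Representation.char_one (V := (specht (Fin n) μ.1).toSubmodule) _

theorem degree_pos {n : ℕ} (μ : Par n) : 0 < degree μ := by
  obtain ⟨T⟩ := nonempty_tableau μ
  have : Nontrivial (specht (Fin n) μ.1).toSubmodule :=
    ⟨spechtPolytabloid T, 0, spechtPolytabloid_ne_zero T⟩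
  exact Module.finrank_pos (R := ℂ) (M := (specht (Fin n) μ.1).toSubmodule)

/-- The part of the regular character that is not accounted for by the Specht modules. -/
noncomputable def regDefect (n : ℕ) : Equiv.Perm (Fin n) → ℂ :=
  regChar (Equiv.Perm (Fin n)) - ∑ μ : Par n, (degree μ : ℂ) • irrChar μ

theorem conj_regDefect {n : ℕ} (σ : Equiv.Perm (Fin n)) :
    conj (regDefect n σ) = regDefect n σ := by
  have : conj (regChar (Equiv.Perm (Fin n)) σ) = regChar (Equiv.Perm (Fin n)) σ := by
    unfold regChar; split_ifs <;> simp
  simp only [regDefect, Pi.sub_apply, Finset.sum_apply, Pi.smul_apply, smul_eq_mul, map_sub,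
    map_sum, map_mul, conj_irrChar, this, map_natCast]

theorem ip_regDefect (n : ℕ) :
    ip (regDefect n) (regDefect n) = n.factorial - ∑ μ : Par n, (degree μ : ℂ) ^ 2 := by
  classical
  rw [regDefect, ip_sub_left, ip_regChar, ip_sub_right, ip_comm _ (regChar _), ip_regChar,
    ip_sum_left]
  simp only [ip_sum_right, ip_irrChar, Pi.sub_apply, Finset.sum_apply, Pi.smul_apply, smul_eq_mul,
    irrChar_one, mul_ite, mul_one, mul_zero, Finset.sum_ite_eq, Finset.mem_univ, if_true, ← sq]
  rw [regChar, if_pos rfl, nat_card_perm_fin]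
  ring

/-- Bessel's inequality for the regular character against the orthonormal characters `irrChar μ`. -/
theorem sum_degree_sq_le (n : ℕ) : ∑ μ : Par n, degree μ ^ 2 ≤ n.factorial := by
  have h := ip_self_re_nonneg (φ := regDefect n) conj_regDefect
  rw [ip_regDefect] at h
  have h2 : ((n.factorial : ℂ) - ∑ μ : Par n, (degree μ : ℂ) ^ 2).re =
      (n.factorial : ℝ) - ((∑ μ : Par n, degree μ ^ 2 : ℕ) : ℝ) := by
    rw [← Complex.ofReal_re ((n.factorial : ℝ) - _)]
    push_cast
    rfl
  rw [h2, sub_nonneg] at h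
  exact_mod_cast h

theorem regChar_eq_sum {n : ℕ} (h : ∑ μ : Par n, degree μ ^ 2 = n.factorial) :
    regChar (Equiv.Perm (Fin n)) = ∑ μ : Par n, (degree μ : ℂ) • irrChar μ := by
  refine sub_eq_zero.mp (eq_zero_of_ip_self_re_nonpos (φ := regDefect n) conj_regDefect ?_)
  rw [ip_regDefect, ← h]
  push_cast
  rw [sub_self, Complex.zero_re]

theorem exists_ip_restrict {n : ℕ} (ρ : Par n) (ν : Par (n + 1)) :
    ∃ m : ℕ, inc ρ ν ≤ m ∧ ip (irrChar ρ) (irrChar ν ∘ permSucc n) = m := by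
  have hinv : ∀ σ, (irrChar ν ∘ permSucc n) σ⁻¹ = (irrChar ν ∘ permSucc n) σ := fun σ => by
    simp only [Function.comp_apply, map_inv, irrChar_inv]
  have hch : irrChar ν ∘ permSucc n =
    Representation.character (V := (specht (Fin (n + 1)) ν.1).toSubmodule)
      ((specht (Fin (n + 1)) ν.1).toRepresentation.comp (permSucc n)) := rfl
  rw [hch] at hinv
  rw [ip_comm, hch, irrChar_eq_character ρ]
  by_cases h : ρ.1 ≤ ν.1
  · rw [inc, if_pos h]
    exact exists_ip_character_eq (V := (specht (Fin (n + 1)) ν.1).toSubmodule)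
      (W := (specht (Fin n) ρ.1).toSubmodule) _ _ hinv (exists_intertwiningMap_restrict h)
  · rw [inc, if_neg h]
    exact ⟨_, Nat.zero_le _, ip_character (V := (specht (Fin (n + 1)) ν.1).toSubmodule)
      (W := (specht (Fin n) ρ.1).toSubmodule) _ _ hinv⟩

theorem degree_eq_sum {n : ℕ} (h : ∑ μ : Par n, degree μ ^ 2 = n.factorial)
    (ν : Par (n + 1)) {m : Par n → ℕ}
    (hm : ∀ ρ, ip (irrChar ρ) (irrChar ν ∘ permSucc n) = m ρ) :
    degree ν = ∑ ρ : Par n, degree ρ * m ρ := by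
  have h1 := ip_regChar (irrChar ν ∘ permSucc n)
  rw [regChar_eq_sum h, ip_sum_left, Function.comp_apply, map_one, irrChar_one] at h1
  simp only [hm] at h1
  exact_mod_cast h1.symm

/-- In the inductive step, completeness for `n` decomposes the restriction, so each degree is at
least the number of chains. Both families have squares related to `(n + 1)!`: equal to it for
chains, at most it for degrees. Hence they agree term by term. -/
theorem degree_eq_numChains {n : ℕ} (ν : Par n) : degree ν = numChains n ν := by
  induction n with
  | zero =>
    have h := sum_degree_sq_le 0
    rw [Fintype.sum_subsingleton _ ν, Nat.factorial_zero] at h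
    have := degree_pos ν
    rw [numChains]
    nlinarith
  | succ n ih =>
    have hn : ∑ μ : Par n, degree μ ^ 2 = n.factorial := by
      simp only [ih, sum_numChains_sq]
    have hle : ∀ ν : Par (n + 1), numChains (n + 1) ν ≤ degree ν := fun ν => by
      choose m hm1 hm2 using fun ρ : Par n => exists_ip_restrict ρ ν
      rw [degree_eq_sum hn ν hm2, numChains]
      refine Finset.sum_le_sum fun ρ _ => ?_
      rw [ih, mul_comm]
      exact Nat.mul_le_mul_left _ (hm1 ρ)
    have hs : ∑ μ : Par (n + 1), numChains (n + 1) μ ^ 2 = ∑ μ : Par (n + 1), degree μ ^ 2 :=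
      le_antisymm (Finset.sum_le_sum fun μ _ => Nat.pow_le_pow_left (hle μ) 2)
        (by rw [sum_numChains_sq]; exact sum_degree_sq_le _)
    have := (Finset.sum_eq_sum_iff_of_le fun μ _ => Nat.pow_le_pow_left (hle μ) 2).mp hs ν
      (mem_univ ν)
    exact (Nat.pow_left_injective two_ne_zero this).symm

theorem sum_degree_sq (n : ℕ) : ∑ μ : Par n, degree μ ^ 2 = n.factorial := by
  simp only [degree_eq_numChains, sum_numChains_sq]

/-- The degree is a sum over `ρ` weighted by multiplicities, and the same sum weighted by `inc`;
with the multiplicities bounded below by `inc` and the degrees positive, the weights coincide. -/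
theorem ip_irrChar_restrict {n : ℕ} (ρ : Par n) (ν : Par (n + 1)) :
    ip (irrChar ρ) (irrChar ν ∘ permSucc n) = inc ρ ν := by
  choose m hm1 hm2 using fun ρ : Par n => exists_ip_restrict ρ ν
  have h1 := degree_eq_sum (sum_degree_sq n) ν hm2
  have h2 : degree ν = ∑ ρ : Par n, degree ρ * inc ρ ν := by
    rw [degree_eq_numChains, numChains]
    exact Finset.sum_congr rfl fun ρ _ => by rw [degree_eq_numChains, mul_comm]
  have := (Finset.sum_eq_sum_iff_of_le fun ρ _ => Nat.mul_le_mul_left (degree ρ) (hm1 ρ)).mp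
    (h2.symm.trans h1) ρ (mem_univ ρ)
  rw [hm2, Nat.eq_of_mul_eq_mul_left (degree_pos ρ) this]

/-- By Schur's lemma `∑ φ(σ) σ` acts on each Specht module as a scalar, and its trace vanishes by
hypothesis, so it acts as zero. As the regular character is a combination of the `irrChar μ`, its
values on translates recover `φ = 0`. -/
theorem eq_zero_of_ip_irrChar_eq_zero {n : ℕ} {φ : Equiv.Perm (Fin n) → ℂ}
    (hφ : ∀ τ σ, φ (τ * σ * τ⁻¹) = φ σ) (h : ∀ μ, ip φ (irrChar μ) = 0) : φ = 0 := by
  have key : ∀ (μ : Par n) g, ∑ σ, φ σ * irrChar μ (σ * g) = 0 := by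
    intro μ g
    have := nonempty_tableau μ
    let ρ := (specht (Fin n) μ.1).toRepresentation
    let A : Module.End ℂ (specht (Fin n) μ.1).toSubmodule := ∑ σ, φ σ • ρ σ
    have hA : ∀ τ, A * ρ τ = ρ τ * A := by
      intro τ
      simp only [A, Finset.sum_mul, Finset.mul_sum]
      refine Fintype.sum_equiv (MulAut.conj τ⁻¹).toEquiv _ _ fun σ => ?_
      have e : (MulAut.conj τ⁻¹).toEquiv σ = τ⁻¹ * σ * τ := by simp
      have e2 : φ (τ⁻¹ * σ * τ) = φ σ := by
        have := hφ τ⁻¹ σ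
        rwa [inv_inv] at this
      rw [e, e2, smul_mul_assoc, mul_smul_comm, ← map_mul, ← map_mul]
      congr 2
      group
    obtain ⟨c, hc⟩ := intertwiningMap_eq_smul (μ := μ.1) (α := Fin n)
      { toLinearMap := A, isIntertwining' := hA }
    have hAc : A = c • 1 := LinearMap.ext hc
    have htr : LinearMap.trace ℂ _ A = 0 := by
      have h1 := h μ
      rw [ip, mul_eq_zero, inv_eq_zero] at h1
      rw [← h1.resolve_left card_cast_ne_zero]
      simp only [A, map_sum, map_smul]
      rfl
    have hc0 : c = 0 := by
      have h1 := irrChar_one μ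
      rw [irrChar, map_one] at h1
      rw [hAc, map_smul, h1, smul_eq_mul, mul_eq_zero] at htr
      exact htr.resolve_right (Nat.cast_ne_zero.mpr (degree_pos μ).ne')
    have h2 : LinearMap.trace ℂ _ (A * ρ g) = 0 := by
      rw [hAc, hc0, zero_smul, zero_mul, map_zero]
    rw [← h2]
    simp only [A, Finset.sum_mul, map_sum, smul_mul_assoc, map_smul, ← map_mul]
    rfl
  have hreg : ∀ g, ∑ σ, φ σ * regChar (Equiv.Perm (Fin n)) (σ * g) = 0 := by
    intro g
    rw [regChar_eq_sum (sum_degree_sq n)]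
    simp only [Finset.sum_apply, Pi.smul_apply, smul_eq_mul, Finset.mul_sum]
    rw [Finset.sum_comm]
    refine Finset.sum_eq_zero fun μ _ => ?_
    rw [← mul_zero (degree μ : ℂ), ← key μ g, Finset.mul_sum]
    exact Finset.sum_congr rfl fun _ _ => by ring
  funext g
  have h3 := hreg g⁻¹
  rw [Finset.sum_eq_single g] at h3
  · have : (Nat.card (Equiv.Perm (Fin n)) : ℂ) ≠ 0 := card_cast_ne_zero
    simpa [regChar, this] using h3
  · intro σ _ hσ
    rw [regChar, if_neg, mul_zero]
    rwa [mul_inv_eq_one]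
  · simp

theorem irrChar_comp_permSucc {n : ℕ} (ν : Par (n + 1)) :
    irrChar ν ∘ permSucc n = ∑ ρ : Par n, (inc ρ ν : ℂ) • irrChar ρ := by
  classical
  refine sub_eq_zero.mp (eq_zero_of_ip_irrChar_eq_zero (fun τ σ => ?_) fun μ => ?_)
  · simp only [Pi.sub_apply, Function.comp_apply, Finset.sum_apply, Pi.smul_apply, map_mul, map_inv,
      irrChar_conj]
  · rw [ip_sub_left, ip_comm, ip_irrChar_restrict, ip_sum_left]
    simp [ip_irrChar]

end SpechtCharacters

/-! ### The character of the hook `(2, 1, …, 1)` -/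

section Hook

/-- The partition of `n` whose Young diagram is a single column. -/
def column (n : ℕ) : Par n :=
  ⟨⟨range n ×ˢ {0}, by
    rintro ⟨a, b⟩ ⟨c, d⟩ hle hab
    have hle' : c ≤ a ∧ d ≤ b := hle
    simp only [coe_product, coe_range, coe_singleton, Set.mem_prod, Set.mem_Iio,
      Set.mem_singleton_iff] at hab ⊢
    omega⟩, by simp [YoungDiagram.card]⟩

theorem mem_column {n i j : ℕ} : (i, j) ∈ (column n).1.cells ↔ i < n ∧ j = 0 := by
  change (i, j) ∈ range n ×ˢ ({0} : Finset ℕ) ↔ _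
  rw [Finset.mem_product, Finset.mem_range, Finset.mem_singleton]

theorem mem_hookTwo {n i j : ℕ} (hn : 2 ≤ n + 1) :
    (i, j) ∈ (hookTwo (n + 1) hn).1.cells ↔ (i < n ∧ j = 0) ∨ (i = 0 ∧ j = 1) := by
  rw [hookTwo, YoungDiagram.mem_cells, YoungDiagram.mem_ofRowLens]
  rcases i with _ | i
  · simp; omega
  · simp
    omega

theorem column_le_column_succ (n : ℕ) : (column n).1 ≤ (column (n + 1)).1 := by
  refine YoungDiagram.cells_subset_iff.mp ?_
  rintro ⟨i, j⟩ h
  rw [mem_column] at h ⊢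
  omega

theorem column_le_hookTwo {n : ℕ} (hn : 2 ≤ n + 1) : (column n).1 ≤ (hookTwo (n + 1) hn).1 := by
  refine YoungDiagram.cells_subset_iff.mp ?_
  rintro ⟨i, j⟩ h
  rw [mem_column] at h
  rw [mem_hookTwo]
  omega

theorem column_ne_hookTwo {n : ℕ} (hn : 2 ≤ n + 1) : column (n + 1) ≠ hookTwo (n + 1) hn := by
  intro h
  have h1 : (0, 1) ∈ (hookTwo (n + 1) hn).1.cells := by rw [mem_hookTwo]; omega
  rw [← h, mem_column] at h1
  omega

theorem eq_of_column_le {n : ℕ} (hn : 2 ≤ n + 1) {ν : Par (n + 1)} (h : (column n).1 ≤ ν.1) :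
    ν = column (n + 1) ∨ ν = hookTwo (n + 1) hn := by
  obtain ⟨⟨i, j⟩, hc, hcν⟩ := exists_insert_cells h
  have hlow : IsLowerSet ((insert (i, j) (column n).1.cells : Finset (ℕ × ℕ)) : Set (ℕ × ℕ)) := by
    rw [hcν]; exact ν.1.isLowerSet
  rw [mem_column] at hc
  have hself : ((i, j) : ℕ × ℕ) ∈
      ((insert (i, j) (column n).1.cells : Finset (ℕ × ℕ)) : Set (ℕ × ℕ)) := by simp
  have hmem : ∀ a b, a ≤ i → b ≤ j → (a = i ∧ b = j) ∨ (a < n ∧ b = 0) := by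
    intro a b ha hb
    have := hlow (show ((a, b) : ℕ × ℕ) ≤ (i, j) from ⟨ha, hb⟩) hself
    rwa [Finset.mem_coe, Finset.mem_insert, mem_column, Prod.mk.injEq] at this
  -- The upper neighbour, the left neighbour and the top of the column of the new box leave only the
  -- two positions. Truncated subtraction on an edge merely returns the box itself.
  have h1 := hmem (i - 1) j (by omega) le_rfl
  have h2 := hmem i (j - 1) le_rfl (by omega)
  have h3 := hmem 0 j (by omega) le_rfl
  have hij : (i = n ∧ j = 0) ∨ (i = 0 ∧ j = 1) := by omega
  rcases hij with ⟨rfl, rfl⟩ | ⟨rfl, rfl⟩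
  · left
    refine Subtype.ext (YoungDiagram.ext ?_)
    rw [← hcν]
    ext ⟨a, b⟩
    rw [Finset.mem_insert, mem_column, mem_column, Prod.mk.injEq]
    omega
  · right
    refine Subtype.ext (YoungDiagram.ext ?_)
    rw [← hcν]
    ext ⟨a, b⟩
    rw [Finset.mem_insert, mem_column, mem_hookTwo, Prod.mk.injEq]
    omega

open Classical in
theorem inc_column {n : ℕ} (hn : 2 ≤ n + 1) (ν : Par (n + 1)) :
    inc (column n) ν =
      (if column (n + 1) = ν then 1 else 0) + if hookTwo (n + 1) hn = ν then 1 else 0 := by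
  by_cases h : (column n).1 ≤ ν.1
  · rw [inc, if_pos h]
    rcases eq_of_column_le hn h with rfl | rfl
    · rw [if_pos rfl, if_neg (column_ne_hookTwo hn).symm]
    · rw [if_pos rfl, if_neg (column_ne_hookTwo hn)]
  · rw [inc, if_neg h, if_neg, if_neg]
    · rintro rfl; exact h (column_le_hookTwo hn)
    · rintro rfl; exact h (column_le_column_succ n)

/-- All labels share one column, so every permutation acts on each polytabloid by its sign. Norm `1`
then forces the degree to be `1`. -/
theorem irrChar_column (n : ℕ) : irrChar (column n) = signChar n := by
  have hcol : ∀ (T : Tableau (Fin n) (column n).1) x, T.col x = 0 := fun T x =>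
    (mem_column.mp ((YoungDiagram.mem_cells _).mpr (T.mem x))).2
  have h1 : ∀ σ, irrChar (column n) σ = signChar n σ * degree (column n) := by
    intro σ
    have hσ : (specht (Fin n) (column n).1).toRepresentation σ = signChar n σ • 1 := by
      refine specht_hom_ext fun T => ?_
      rw [toRepresentation_spechtPolytabloid]
      exact Subtype.ext (polytabloid_act T fun x => by rw [hcol, hcol])
    have h2 := irrChar_one (column n)
    rw [irrChar, map_one] at h2
    rw [irrChar, hσ, map_smul, h2, smul_eq_mul]
  have h2 := ip_irrChar_self (column n)
  have h3 : ∀ σ, irrChar (column n) σ * irrChar (column n) σ = (degree (column n) : ℂ) ^ 2 :=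
    fun σ => by
      rw [h1]
      linear_combination (degree (column n) : ℂ) ^ 2 * signChar_mul_self σ
  have h4 : (degree (column n) : ℂ) ^ 2 = 1 := by
    rw [ip] at h2
    simp only [h3, Finset.sum_const, Finset.card_univ, nsmul_eq_mul] at h2
    rwa [Nat.card_eq_fintype_card, inv_mul_cancel_left₀ (by simp)] at h2
  have h5 : degree (column n) = 1 := by
    have : degree (column n) ^ 2 = 1 := by exact_mod_cast h4
    simpa using this
  funext σ
  rw [h1, h5, Nat.cast_one, mul_one]

/-- The number of fixed points of a permutation. -/
noncomputable def fixChar (n : ℕ) (σ : Equiv.Perm (Fin n)) : ℂ := ∑ x, if σ x = x then 1 else 0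

theorem sum_fixChar_mul {n : ℕ} {F : Equiv.Perm (Fin (n + 1)) → ℂ}
    (hF : ∀ τ σ, F (τ * σ * τ⁻¹) = F σ) :
    ∑ σ, fixChar (n + 1) σ * F σ = (n + 1) * ∑ τ, F (permSucc n τ) := by
  have key : ∀ x : Fin (n + 1), ∑ σ : Equiv.Perm (Fin (n + 1)), (if σ x = x then F σ else 0) =
      ∑ τ, F (permSucc n τ) := by
    intro x
    have h0 := sum_perm_fin_succ (fun σ => if σ 0 = 0 then F σ else 0) fun σ h => if_neg h
    simp only [permSucc_apply_zero, if_true] at h0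
    rw [← h0]
    refine Fintype.sum_equiv (MulAut.conj (Equiv.swap 0 x)).toEquiv _ _ fun σ => ?_
    change _ = if (Equiv.swap 0 x * σ * (Equiv.swap 0 x)⁻¹) 0 = 0 then
      F (Equiv.swap 0 x * σ * (Equiv.swap 0 x)⁻¹) else 0
    rw [hF, Equiv.swap_inv, Equiv.Perm.mul_apply, Equiv.Perm.mul_apply, Equiv.swap_apply_left]
    have : Equiv.swap 0 x (σ x) = 0 ↔ σ x = x := by
      rw [Equiv.swap_apply_eq_iff, Equiv.swap_apply_left]
    simp only [this]
  simp only [fixChar, Finset.sum_mul, ite_mul, one_mul, zero_mul]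
  rw [Finset.sum_comm]
  simp only [key, Finset.sum_const, Finset.card_univ, Fintype.card_fin, nsmul_eq_mul]
  push_cast
  ring

/-- Frobenius reciprocity for the permutation character: each point stabilizer is conjugate to the
copy of `S_n` fixing `0`. -/
theorem average_fixChar_mul {n : ℕ} {F : Equiv.Perm (Fin (n + 1)) → ℂ}
    (hF : ∀ τ σ, F (τ * σ * τ⁻¹) = F σ) :
    ((n + 1).factorial : ℂ)⁻¹ * ∑ σ, fixChar (n + 1) σ * F σ =
      (n.factorial : ℂ)⁻¹ * ∑ τ, F (permSucc n τ) := by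
  rw [sum_fixChar_mul hF, Nat.factorial_succ]
  have h1 : (n.factorial : ℂ) ≠ 0 := Nat.cast_ne_zero.mpr n.factorial_ne_zero
  have h2 : (n + 1 : ℂ) ≠ 0 := Nat.cast_add_one_ne_zero n
  push_cast
  field_simp

theorem fixChar_conj {n : ℕ} (τ σ : Equiv.Perm (Fin n)) :
    fixChar n (τ * σ * τ⁻¹) = fixChar n σ := by
  refine (Fintype.sum_equiv τ _ _ fun x => ?_).symm
  simp

/-- `sgn * fix` is induced from the sign character of `S_n`. Its constituents are the shapes
obtained by adding a box to a column: the longer column, which is `sgn`, and the hook. -/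
theorem irrChar_hookTwo {n : ℕ} (hn : 2 ≤ n + 1) :
    irrChar (hookTwo (n + 1) hn) = signChar (n + 1) * (fixChar (n + 1) - 1) := by
  classical
  have key : signChar (n + 1) * fixChar (n + 1) - signChar (n + 1) -
      irrChar (hookTwo (n + 1) hn) = 0 := by
    refine eq_zero_of_ip_irrChar_eq_zero (fun τ σ => ?_) fun ν => ?_
    · simp only [Pi.sub_apply, Pi.mul_apply, signChar_conj, fixChar_conj, irrChar_conj]
    · have h1 : ip (signChar (n + 1) * fixChar (n + 1)) (irrChar ν) =
          ip (signChar n) (irrChar ν ∘ permSucc n) := by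
        have := average_fixChar_mul (F := fun σ => signChar (n + 1) σ * irrChar ν σ)
          fun τ σ => by rw [signChar_conj, irrChar_conj]
        rw [ip, ip, nat_card_perm_fin, nat_card_perm_fin]
        refine Eq.trans ?_ (this.trans ?_)
        · congr 1
          refine Finset.sum_congr rfl fun σ _ => ?_
          rw [Pi.mul_apply]; ring
        · simp only [signChar, sign_permSucc, Function.comp_apply]
      rw [ip_sub_left, ip_sub_left, h1, ← irrChar_column, ← irrChar_column, ip_irrChar_restrict,
        ip_irrChar, ip_irrChar, inc_column hn]
      push_cast
      ring
  rw [← sub_eq_zero.mp key, mul_sub, mul_one]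

end Hook

/-! ### The Kronecker coefficients -/

section Kronecker

open Classical in
theorem kronecker_hookTwo {n : ℕ} (hn : 2 ≤ n + 1) (ν κ : Par (n + 1)) :
    kronecker (hookTwo (n + 1) hn) ν.transpose κ =
      ((∑ ρ : Par n, inc ρ ν * inc ρ κ : ℕ) : ℂ) - if ν = κ then 1 else 0 := by
  have h1 : kronecker (hookTwo (n + 1) hn) ν.transpose κ =
      ((n + 1).factorial : ℂ)⁻¹ * ∑ σ, fixChar (n + 1) σ * (irrChar ν σ * irrChar κ σ) -
        ip (irrChar ν) (irrChar κ) := by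
    rw [kronecker, ip, nat_card_perm_fin, one_div, ← mul_sub, ← Finset.sum_sub_distrib,
      irrChar_hookTwo hn, irrChar_transpose]
    congr 1
    refine Finset.sum_congr rfl fun σ _ => ?_
    simp only [Pi.mul_apply, Pi.sub_apply, Pi.one_apply]
    linear_combination (fixChar (n + 1) σ - 1) * irrChar ν σ * irrChar κ σ * signChar_mul_self σ
  have h2 : (n.factorial : ℂ)⁻¹ * ∑ τ, irrChar ν (permSucc n τ) * irrChar κ (permSucc n τ) =
      ip (irrChar ν ∘ permSucc n) (irrChar κ ∘ permSucc n) := by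
    rw [ip, nat_card_perm_fin]; rfl
  rw [h1, average_fixChar_mul (F := fun σ => irrChar ν σ * irrChar κ σ)
    fun τ σ => by rw [irrChar_conj, irrChar_conj], h2, ip_irrChar, irrChar_comp_permSucc ν,
    ip_sum_left]
  simp only [ip_irrChar_restrict]
  push_cast
  rfl

theorem sum_inc_mul_inc_sq {n : ℕ} {ν κ : Par (n + 1)} (h : ν ≠ κ) :
    (∑ ρ : Par n, inc ρ ν * inc ρ κ) ^ 2 = ∑ ρ : Par n, inc ρ ν * inc ρ κ := by
  rw [sum_inc_mul_inc_of_ne h]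
  split_ifs <;> rfl

theorem kronecker_hookTwo_self {n : ℕ} (hn : 2 ≤ n + 1) (ν : Par (n + 1)) :
    kronecker (hookTwo (n + 1) hn) ν.transpose ν = (numCorners ν.1 : ℂ) - 1 := by
  rw [kronecker_hookTwo, if_pos rfl]
  simp only [inc_mul_self, sum_inc_left]

/-- Off the diagonal the number of common subdiagrams is `0` or `1`, hence its own square. The
diagonal term corrects for `C(ν)` being used in place of `(C(ν) - 1)^2`. -/
theorem kronecker_hookTwo_sq {n : ℕ} (hn : 2 ≤ n + 1) (ν κ : Par (n + 1)) :
    kronecker (hookTwo (n + 1) hn) ν.transpose κ ^ 2 =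
      ((∑ ρ : Par n, inc ρ ν * inc ρ κ : ℕ) : ℂ) +
        open Classical in
        if ν = κ then ((numCorners ν.1 : ℂ) - 1) ^ 2 - numCorners ν.1 else 0 := by
  by_cases h : ν = κ
  · subst h
    rw [kronecker_hookTwo_self, if_pos rfl]
    simp only [inc_mul_self, sum_inc_left]
    ring
  · rw [kronecker_hookTwo, if_neg h, if_neg h, sub_zero, add_zero, ← Nat.cast_pow,
      sum_inc_mul_inc_sq h]

theorem sum_sum_inc_mul_inc (n : ℕ) :
    ∑ ν : Par (n + 1), ∑ κ : Par (n + 1), ∑ ρ : Par n, inc ρ ν * inc ρ κ =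
      ∑ ρ : Par n, (numCorners ρ.1 + 1) ^ 2 := by
  have h : ∀ ν : Par (n + 1), ∑ κ : Par (n + 1), ∑ ρ : Par n, inc ρ ν * inc ρ κ =
      ∑ ρ : Par n, inc ρ ν * (numCorners ρ.1 + 1) := fun ν => by
    rw [Finset.sum_comm]
    simp only [← Finset.mul_sum, sum_inc_right]
  simp only [h]
  rw [Finset.sum_comm]
  simp only [← Finset.sum_mul, sum_inc_right, sq]

theorem sum_numCorners (n : ℕ) :
    ∑ ν : Par (n + 1), numCorners ν.1 = ∑ ρ : Par n, (numCorners ρ.1 + 1) := by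
  simp only [← sum_inc_left, ← sum_inc_right]
  exact Finset.sum_comm

end Kronecker

end SymKron

/-! ### Assembly of the three claims. -/

theorem mainTheorem5 (n : ℕ) (hn : 2 ≤ n) :
    (∀ ν κ : SymKron.Par n, ν ≠ κ →
      SymKron.kronecker (SymKron.hookTwo n hn) ν.transpose κ = 0 ∨
        SymKron.kronecker (SymKron.hookTwo n hn) ν.transpose κ = 1) ∧
    (∀ ν : SymKron.Par n,
      SymKron.kronecker (SymKron.hookTwo n hn) ν.transpose ν =
        (SymKron.numCorners ν.1 : ℂ) - 1) ∧
    ∑ ν : SymKron.Par n, ∑ κ : SymKron.Par n,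
        SymKron.kronecker (SymKron.hookTwo n hn) ν.transpose κ ^ 2 =
      ∑ ρ : SymKron.Par (n - 1),
          (SymKron.numCorners ρ.1 : ℂ) * ((SymKron.numCorners ρ.1 : ℂ) + 1) +
        ∑ ρ : SymKron.Par n, ((SymKron.numCorners ρ.1 : ℂ) - 1) ^ 2 := by
  obtain ⟨n, rfl⟩ : ∃ m, n = m + 1 := ⟨n - 1, by omega⟩
  refine ⟨fun ν κ h => ?_, fun ν => SymKron.kronecker_hookTwo_self hn ν, ?_⟩
  · rw [SymKron.kronecker_hookTwo, if_neg h, sub_zero, SymKron.sum_inc_mul_inc_of_ne h]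
    split_ifs
    · exact Or.inr Nat.cast_one
    · exact Or.inl Nat.cast_zero
  · simp only [SymKron.kronecker_hookTwo_sq, Finset.sum_add_distrib, Finset.sum_ite_eq,
      Finset.mem_univ, if_true, Finset.sum_sub_distrib]
    have h1 := congrArg (Nat.cast : ℕ → ℂ) (SymKron.sum_sum_inc_mul_inc n)
    have h2 := congrArg (Nat.cast : ℕ → ℂ) (SymKron.sum_numCorners n)
    -- `(C + 1)^2` counts the ordered pairs of diagrams above `ρ`, and the subtracted `C + 1` comes
    -- from recounting the corners of all `ν` from below.
    have h3 : ∑ ρ : SymKron.Par n, (SymKron.numCorners ρ.1 : ℂ) *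
        ((SymKron.numCorners ρ.1 : ℂ) + 1) =
        ∑ ρ : SymKron.Par n, ((SymKron.numCorners ρ.1 : ℂ) + 1) ^ 2 -
          ∑ ρ : SymKron.Par n, ((SymKron.numCorners ρ.1 : ℂ) + 1) := by
      rw [← Finset.sum_sub_distrib]
      exact Finset.sum_congr rfl fun _ _ => by ring
    push_cast at h1 h2 ⊢
    change _ = ∑ ρ : SymKron.Par n, (SymKron.numCorners ρ.1 : ℂ) *
        ((SymKron.numCorners ρ.1 : ℂ) + 1) + _
    rw [h1, h2, h3]
    ring
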